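/- **Setting.** Let $X_1,\dots,X_{n_1}\overset{iid}{\sim} N_p(\mu_1,\Sigma_1)$ and $Y_1,\dots,Y_{n_2}\overset{iid}{\sim} N_p(\mu_2,\Sigma_2)$ be two independent Gaussian samples, $\Sigma_k=(\sigma_{ijk})$, with correlations $\rho_{ijk}=\sigma_{ijk}/\sqrt{\sigma_{iik}\sigma_{jjk}}$. Put $q=p(p+1)/2$, $n=n_1n_2/(n_1+n_2)$ and $\delta_{ij}=\sigma_{ij1}-\sigma_{ij2}$. Let $\theta_{ij1}=\operatorname{Var}\{(X_{1i}-\mu_{1i})(X_{1j}-\mu_{1j})\}$ and let $\rho^{(1)}_{ij,lm}$ be the correlation of $(X_{1i}-\mu_{1i})(X_{1j}-\mu_{1j})$ and $(X_{1l}-\mu_{1l})(X_{1m}-\mu_{1m})$; define $\theta_{ij2}$, $\rho^{(2)}_{ij,lm}$ in the same way from $Y_1$. For $\sigma$-fields $\mathcal A,\mathcal B$ let $\zeta(\mathcal A,\mathcal B)=\frac12\sup\sum_{l_1,l_2}|P(A_{l_1}\cap B_{l_2})-P(A_{l_1})P(B_{l_2})|$, the supremum being over all finite partitions $\{A_{l_1}\}\subset\mathcal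 A$, $\{B_{l_2}\}\subset\mathcal B$ of the sample space, and for a random vector $Z=(Z_1,\dots,Z_p)$ let $\zeta_Z(h)=\sup_{1\le m\le p-h}\zeta\{\sigma(Z_1,\dots,Z_m),\sigma(Z_{m+h},\dots,Z_p)\}$. Fix constants $\tau,\rho_0,\gamma\in(0,1)$ and $C>0$. Call a pair $(\Sigma_1,\Sigma_2)$ of $p\times p$ covariance matrices *regular* if, for $k=1,2$, 1. $\tau<\sigma_{iik}<\tau^{-1}$ and $\theta_{ijk}/(\sigma_{iik}\sigma_{jjk})>\tau$ for all $i,j$; 2. $|\rho_{ijk}|<1-\rho_0$ for all $i\neq j$, and $|\rho^{(k)}_{ij,lm}|<1-\rho_0$ for all $i\le j$, $l\le m$ with $(i,j)\ne(l,m)$; 3. there is a permutation $\pi$ of $\{1,\dots,p\}$, the same for both populations, such that the vectors $(X_{1\pi(1)},\dots,X_{1\pi(p)})$ and $(Y_{1\pi(1)},\dots,Y_{1\pi(p)})$ both have $\zeta(h)\le C\gamma^h$ for all $1\le h\le p-1$. For given means, let $\mathcal W_\alpha$ be the set of all (possibly randomized) tests $W_\alpha$ based on the two samples with $P(W_\alpha=1)\le\alpha$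 whenever $\Sigma_1=\Sigma_2=\Sigma$ and $(\Sigma,\Sigma)$ is regular. For $c>0$ let $\underline{\mathcal C}(\beta,c)$ be the set of regular pairs $(\Sigma_1,\Sigma_2)$ for which exactly $\lfloor q^{1-\beta}\rfloor$ of the $\delta_{ij}$, $i\le j$, are nonzero and every nonzero one is $\delta_{ij}=\sqrt{2r_{0,ij}\log q/n}$ with some $r_{0,ij}\ge c$ (so $\delta_{ij}\ge\sqrt{2c\log q/n}$). **Theorem 3.** Let $0<\xi<2$, $\alpha>0$, $0<\omega<1-\alpha$ and $\max\{2/3,(3-\xi)/4\}<\beta<1$. There exists a constant $c_0>0$ such that, whenever $n\to\infty$ and $p\to\infty$ with $n\asymp p^{\xi}$, for all sufficiently late terms of the sequence and for all means $\mu_1,\mu_2\in\mathbb R^p$, $$\sup_{W_\alpha\in\mathcal W_\alpha}\ \inf_{(\Sigma_1,\Sigma_2)\in\underline{\mathcal C}(\beta,c_0)}P(W_\alpha=1)\ \le\ 1-\omega .$$ Thus no $\alpha$-level test has power tending to one uniformly over $\underline{\mathcal C}(\beta,c_0)$: the order $\sqrt{\log p/n}$ of the signal is a lower bound for uniform detection.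 -/

import Mathlib

open MeasureTheory ProbabilityTheory Filter Asymptotics
open scoped ENNReal

noncomputable section

namespace CovTest

/-- The sample space of one `p`-dimensional observation. -/
abbrev Vec (p : ℕ) : Type := EuclideanSpace ℝ (Fin p)

/-- The sample space of the two samples `(X_1, …, X_{n₁})` and `(Y_1, …, Y_{n₂})`. -/
abbrev Data (p n₁ n₂ : ℕ) : Type := (Fin n₁ → Vec p) × (Fin n₂ → Vec p)

/-- The joint law of two independent i.i.d. Gaussian samples, the first one from `N(μ₁, S₁)`, the
second one from `N(μ₂, S₂)`. -/
def sampleLaw {p : ℕ} (n₁ n₂ : ℕ) (μ₁ μ₂ : Vec p) (S₁ S₂ : Matrix (Fin p) (Fin p) ℝ) :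
    Measure (Data p n₁ n₂) :=
  (Measure.pi fun _ : Fin n₁ => multivariateGaussian μ₁ S₁).prod
    (Measure.pi fun _ : Fin n₂ => multivariateGaussian μ₂ S₂)

/-- The effective sample size `n = n₁ n₂ / (n₁ + n₂)`. -/
def effSize (n₁ n₂ : ℕ) : ℝ := (n₁ : ℝ) * n₂ / ((n₁ : ℝ) + n₂)

/-- The number `q = p (p + 1) / 2` of distinct entries of a symmetric `p × p` matrix. -/
def numEntries (p : ℕ) : ℝ := (p : ℝ) * ((p : ℝ) + 1) / 2

/-- Polynomial growth: along the sequence of dimensions and sample sizes, `p → ∞`, `n → ∞` and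
`n ∼ p ^ ξ` (equality up to two positive constant factors). -/
structure PolynomialGrowth (ξ : ℝ) (p n₁ n₂ : ℕ → ℕ) : Prop where
  dim : Tendsto p atTop atTop
  size : Tendsto (fun k => effSize (n₁ k) (n₂ k)) atTop atTop
  rate : (fun k => effSize (n₁ k) (n₂ k)) =Θ[atTop] fun k => (p k : ℝ) ^ ξ

/-! ### Moments of a Gaussian vector -/

/-- The product `(X_i - μ_i) (X_j - μ_j)` of two centred coordinates. -/
def centredProd {p : ℕ} (μ : Vec p) (i j : Fin p) : Vec p → ℝ :=
  fun x => (x i - μ i) * (x j - μ j)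

/-- `θ_{ij} = Var {(X_i - μ_i) (X_j - μ_j)}` for `X ∼ N(μ, S)`. -/
def theta {p : ℕ} (μ : Vec p) (S : Matrix (Fin p) (Fin p) ℝ) (i j : Fin p) : ℝ :=
  variance (centredProd μ i j) (multivariateGaussian μ S)

/-- The correlation `ρ_{ij} = σ_{ij} / √(σ_{ii} σ_{jj})`. -/
def corr {p : ℕ} (S : Matrix (Fin p) (Fin p) ℝ) (i j : Fin p) : ℝ :=
  S i j / Real.sqrt (S i i * S j j)

/-- `ρ_{ij,lm} = Cor {(X_i - μ_i) (X_j - μ_j), (X_l - μ_l) (X_m - μ_m)}` for `X ∼ N(μ, S)`. -/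
def prodCorr {p : ℕ} (μ : Vec p) (S : Matrix (Fin p) (Fin p) ℝ) (i j l m : Fin p) : ℝ :=
  covariance (centredProd μ i j) (centredProd μ l m) (multivariateGaussian μ S) /
    Real.sqrt (theta μ S i j * theta μ S l m)

/-! ### `β`-mixing -/

/-- A finite partition of `Ω`, indexed by `Fin u`, into sets of the `σ`-field `𝓐`. -/
structure IsFinPartition {Ω : Type*} (𝓐 : MeasurableSpace Ω) {u : ℕ} (A : Fin u → Set Ω) :
    Prop where
  measurable : ∀ l, MeasurableSet[𝓐] (A l)
  disjoint : Pairwise fun l l' => Disjoint (A l) (A l')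
  cover : ⋃ l, A l = Set.univ

/-- The `β`-mixing coefficient of two `σ`-fields,
`ζ(𝓐, 𝓑) = (1/2) sup ∑ ∑ |P(A_l ∩ B_l') - P(A_l) P(B_l')|`, where the supremum is over all finite
partitions of the sample space into sets of `𝓐` and into sets of `𝓑`. -/
def betaCoeff {Ω : Type*} {_ : MeasurableSpace Ω} (P : Measure Ω) (𝓐 𝓑 : MeasurableSpace Ω) :
    ℝ≥0∞ :=
  ⨆ (u₁ : ℕ) (u₂ : ℕ) (A : Fin u₁ → Set Ω) (B : Fin u₂ → Set Ω)
    (_ : IsFinPartition 𝓐 A) (_ : IsFinPartition 𝓑 B),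
    ENNReal.ofReal
      ((1 / 2) * ∑ l₁, ∑ l₂, |P.real (A l₁ ∩ B l₂) - P.real (A l₁) * P.real (B l₂)|)

/-- The `σ`-field generated by the coordinates with (one-based) positions `a, …, b` of the vector
`(X_{π(1)}, …, X_{π(p)})`. -/
@[reducible] def coordField {p : ℕ} (π : Equiv.Perm (Fin p)) (a b : ℕ) : MeasurableSpace (Vec p) :=
  ⨆ (j : Fin p) (_ : a ≤ (j : ℕ) + 1 ∧ (j : ℕ) + 1 ≤ b),
    MeasurableSpace.comap (fun x : Vec p => x (π j)) inferInstance

/-- The `β`-mixing coefficient at lag `h` of the vector `(X_{π(1)}, …, X_{π(p)})`, `X ∼ P`. -/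
def mixingCoeff {p : ℕ} (P : Measure (Vec p)) (π : Equiv.Perm (Fin p)) (h : ℕ) : ℝ≥0∞ :=
  ⨆ (m : ℕ) (_ : 1 ≤ m ∧ m + h ≤ p), betaCoeff P (coordField π 1 m) (coordField π (m + h) p)

/-! ### The conditions on the two Gaussian populations -/

/-- The constants that occur in the conditions. -/
structure Params where
  (τ ρ₀ C γ : ℝ)

/-- The constants are in the range in which the conditions make sense. -/
structure Params.Admissible (K : Params) : Prop where
  τ_mem : K.τ ∈ Set.Ioo 0 1
  ρ₀_mem : K.ρ₀ ∈ Set.Ioo 0 1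
  C_pos : 0 < K.C
  γ_mem : K.γ ∈ Set.Ioo 0 1

/-- The variances are in `(τ, 1/τ)` and the normalized variances of the products of two centred
coordinates exceed `τ`. -/
structure BoundedVariances {p : ℕ} (τ : ℝ) (μ : Vec p) (S : Matrix (Fin p) (Fin p) ℝ) : Prop where
  lower : ∀ i, τ < S i i
  upper : ∀ i, S i i < τ⁻¹
  prod : ∀ i j, τ < theta μ S i j / (S i i * S j j)

/-- All correlations of distinct coordinates, and of products of two coordinates that belong to
distinct unordered pairs of indices, are less than `1 - ρ₀` in absolute value. -/
structure BoundedCorrelations {p : ℕ} (ρ₀ : ℝ) (μ : Vec p) (S : Matrix (Fin p) (Fin p) ℝ) :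
    Prop where
  coord : ∀ i j, i ≠ j → |corr S i j| < 1 - ρ₀
  prod : ∀ i j l m, i ≤ j → l ≤ m → (i, j) ≠ (l, m) → |prodCorr μ S i j l m| < 1 - ρ₀

/-- There is one permutation of the coordinates after which both populations are `β`-mixing with
coefficients at most `C γ ^ h`. -/
def JointlyMixing {p : ℕ} (C γ : ℝ) (μ₁ μ₂ : Vec p) (S₁ S₂ : Matrix (Fin p) (Fin p) ℝ) : Prop :=
  ∃ π : Equiv.Perm (Fin p), ∀ h : ℕ, 1 ≤ h → h + 1 ≤ p →
    mixingCoeff (multivariateGaussian μ₁ S₁) π h ≤ ENNReal.ofReal (C * γ ^ h) ∧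
    mixingCoeff (multivariateGaussian μ₂ S₂) π h ≤ ENNReal.ofReal (C * γ ^ h)

/-- `S₁`, `S₂` are covariance matrices, and the populations `N(μ₁, S₁)`, `N(μ₂, S₂)` satisfy all
the conditions with the constants `K`. -/
structure Regular {p : ℕ} (K : Params) (μ₁ μ₂ : Vec p) (S₁ S₂ : Matrix (Fin p) (Fin p) ℝ) :
    Prop where
  posSemidef₁ : S₁.PosSemidef
  posSemidef₂ : S₂.PosSemidef
  variances₁ : BoundedVariances K.τ μ₁ S₁
  variances₂ : BoundedVariances K.τ μ₂ S₂
  correlations₁ : BoundedCorrelations K.ρ₀ μ₁ S₁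
  correlations₂ : BoundedCorrelations K.ρ₀ μ₂ S₂
  mixing : JointlyMixing K.C K.γ μ₁ μ₂ S₁ S₂

/-! ### Tests and alternatives -/

/-- The probability that the test with critical function `W` rejects. A test is given by its
critical function `W`, the conditional probability of rejection given the data; for a
nonrandomized test `W` is `0` or `1` and this is the probability of `W = 1`. -/
def rejectProb {p n₁ n₂ : ℕ} (μ₁ μ₂ : Vec p) (S₁ S₂ : Matrix (Fin p) (Fin p) ℝ)
    (W : Data p n₁ n₂ → ℝ≥0∞) : ℝ≥0∞ :=
  ∫⁻ d, W d ∂(sampleLaw n₁ n₂ μ₁ μ₂ S₁ S₂)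

/-- The `α`-level tests of the hypothesis of equal covariance matrices: the probability of
rejection is at most `α` for all regular populations with a common covariance matrix. -/
def levelTests {p : ℕ} (n₁ n₂ : ℕ) (K : Params) (α : ℝ) (μ₁ μ₂ : Vec p) :
    Set (Data p n₁ n₂ → ℝ≥0∞) :=
  {W | Measurable W ∧ (∀ d, W d ≤ 1) ∧
    ∀ S : Matrix (Fin p) (Fin p) ℝ, Regular K μ₁ μ₂ S S →
      rejectProb μ₁ μ₂ S S W ≤ ENNReal.ofReal α}

/-- The set of positions `i ≤ j` at which the two covariance matrices differ. -/
def support {p : ℕ} (S₁ S₂ : Matrix (Fin p) (Fin p) ℝ) : Set (Fin p × Fin p) :=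
  {e | e.1 ≤ e.2 ∧ S₁ e.1 e.2 - S₂ e.1 e.2 ≠ 0}

/-- The class of sparse alternatives: regular pairs `(S₁, S₂)` with exactly `⌊q ^ (1 - β)⌋` nonzero
differences `δ_{ij}`, `i ≤ j`, each of the form `√(2 r log q / n)` with `r ≥ c`. -/
def sparseClass {p : ℕ} (n₁ n₂ : ℕ) (K : Params) (β c : ℝ) (μ₁ μ₂ : Vec p) :
    Set (Matrix (Fin p) (Fin p) ℝ × Matrix (Fin p) (Fin p) ℝ) :=
  {S | Regular K μ₁ μ₂ S.1 S.2 ∧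
    (support S.1 S.2).ncard = ⌊numEntries p ^ (1 - β)⌋₊ ∧
    ∀ e ∈ support S.1 S.2, ∃ r : ℝ, c ≤ r ∧
      S.1 e.1 e.2 - S.2 e.1 e.2 =
        Real.sqrt (2 * r * Real.log (numEntries p) / effSize n₁ n₂)}

end CovTest

end

namespace CovTest

/-! ### The density of a bivariate Gaussian vector with respect to the standard one -/

/-! The proof is a second moment argument. The null point is the pair of identity matrices. An
alternative puts correlation `ε` on `m = ⌊q ^ (1 - β)⌋` disjoint pairs of coordinates in one sample
only. The coordinates are split into `m` groups, each with `s ≈ p / (2m)` candidates for the left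
end and `s` for the right end of its pair, so every group offers `s²` choices. A test that detects
all alternatives also detects their uniform mixture; hence it suffices that the mixture has
`χ²`-distance tending to zero from the null (`exists_lintegral_withDensity_le`).

Let `L e` be the likelihood ratio of the choice `e`. Both marginals of a correlated pair stay
standard, so two pairs that share no end or one end contribute a factor `1` to `E (L e * L f)`, and
a common pair contributes `(1 - ε²)⁻¹` per observation (`lintegral_mul_mehler_mul_mehler`).
Averaging over the choices gives at most `(1 + (1 - ε²)⁻ⁿ / s²) ^ m ≤ exp (m (1 - ε²)⁻ⁿ / s²)`, with
`n` the size of the perturbed sample (`sum_sum_prod_ite_le`). The smaller sample is perturbed, so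
this size is at most twice the effective one, and `ε² = 2 c₀ log q / n` makes `(1 - ε²)⁻ⁿ` a small
power of `q`. Since `m / s²` is of order `m³ / q ≤ q ^ (2 - 3β)`, the exponent tends to zero when `β
> 2/3` and `c₀` is small (`exponent_le`).

The alternatives must also be regular. Weak correlations settle the moment conditions by Isserlis'
theorem. For mixing, a permutation places the two ends of each pair side by side: at lag two or more
the blocks are independent, and at lag one a single pair straddles the cut, so the coefficient is of
order `ε` (`mixingCoeff_pairCov_le`). The means only shift the data, so all bounds are uniform in
them. -/

lemma one_sub_sq_pos {ε : ℝ} (hε : |ε| < 1) : 0 < 1 - ε ^ 2 := by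
  have := (sq_lt_one_iff_abs_lt_one ε).2 hε
  linarith

/-- The density of `N(0, (1, ε; ε, 1))` with respect to `N(0, I)`. -/
noncomputable def mehler (ε x y : ℝ) : ℝ≥0∞ :=
  ENNReal.ofReal ((√(1 - ε ^ 2))⁻¹ *
    Real.exp (-(ε ^ 2 * x ^ 2 - 2 * ε * x * y + ε ^ 2 * y ^ 2) / (2 * (1 - ε ^ 2))))

lemma mehler_comm (ε x y : ℝ) : mehler ε x y = mehler ε y x := by
  unfold mehler
  congr 4
  ring

@[fun_prop]
lemma measurable_mehler {Ω : Type*} [MeasurableSpace Ω] (ε : ℝ) {f g : Ω → ℝ}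
    (hf : Measurable f) (hg : Measurable g) : Measurable (fun ω => mehler ε (f ω) (g ω)) := by
  unfold mehler
  fun_prop

/-- As the first marginal is standard, the joint density ratio is at the same time the ratio of the
conditional density of `y` given `x` to the standard one. -/
lemma gaussianPDF_mul_mehler {ε : ℝ} (hε : |ε| < 1) (x y : ℝ) :
    gaussianPDF 0 1 y * mehler ε x y = gaussianPDF (ε * x) (1 - ε ^ 2).toNNReal y := by
  have h := one_sub_sq_pos hε
  unfold gaussianPDF mehler gaussianPDFReal
  rw [← ENNReal.ofReal_mul (by positivity), Real.coe_toNNReal _ h.le,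
    Real.sqrt_mul (by positivity) (1 - ε ^ 2)]
  congr 1
  rw [mul_mul_mul_comm, ← Real.exp_add, ← mul_inv]
  congr 2
  · simp
  · simp only [NNReal.coe_one]
    field_simp
    ring

lemma gaussianReal_withDensity_mehler {ε : ℝ} (hε : |ε| < 1) (x : ℝ) :
    (gaussianReal 0 1).withDensity (mehler ε x) =
      gaussianReal (ε * x) (1 - ε ^ 2).toNNReal := by
  have h := one_sub_sq_pos hε
  rw [gaussianReal_of_var_ne_zero _ one_ne_zero,
    gaussianReal_of_var_ne_zero _ (by simpa using h),
    ← withDensity_mul _ (measurable_gaussianPDF _ _) (by fun_prop)]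
  congr 1
  ext y
  exact gaussianPDF_mul_mehler hε x y

/-- Integration against the conditional law of the second coordinate given the first one. -/
lemma lintegral_mul_mehler {ε : ℝ} (hε : |ε| < 1) (x : ℝ) {f : ℝ → ℝ≥0∞} (hf : Measurable f) :
    ∫⁻ y, f y * mehler ε x y ∂(gaussianReal 0 1) =
      ∫⁻ y, f (ε * x + √(1 - ε ^ 2) * y) ∂(gaussianReal 0 1) := by
  have h := one_sub_sq_pos hε
  have hmap : (gaussianReal 0 1).map (fun y => ε * x + √(1 - ε ^ 2) * y) =
      gaussianReal (ε * x) (1 - ε ^ 2).toNNReal := by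
    have : (fun y => ε * x + √(1 - ε ^ 2) * y) =
      (fun y => ε * x + y) ∘ fun y => √(1 - ε ^ 2) * y := rfl
    rw [this, ← Measure.map_map (by fun_prop) (by fun_prop), gaussianReal_map_const_mul,
      gaussianReal_map_const_add]
    congr 1
    · simp
    · ext
      simp [Real.sq_sqrt h.le, Real.coe_toNNReal _ h.le]
  rw [← lintegral_map hf (by fun_prop), hmap, ← gaussianReal_withDensity_mehler hε,
    lintegral_withDensity_eq_lintegral_mul _ (by fun_prop) hf]
  simp [mul_comm]

/-- Completing the square in `y` turns the weighted square into a multiple of the Gaussian density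
with mean `2εx / (1 + ε²)` and variance `v`. -/
lemma lintegral_mehler_sq {ε : ℝ} (hε : |ε| < 1) (x : ℝ) :
    ∫⁻ y, mehler ε x y ^ 2 ∂(gaussianReal 0 1) =
      ENNReal.ofReal ((1 - ε ^ 2)⁻¹ * √((1 - ε ^ 2) / (1 + ε ^ 2)) *
        Real.exp (ε ^ 2 * x ^ 2 / (1 + ε ^ 2))) := by
  have h := one_sub_sq_pos hε
  set v := (1 - ε ^ 2) / (1 + ε ^ 2) with hv
  have hv0 : 0 < v := by positivity
  have key : ∀ y, gaussianPDF 0 1 y * mehler ε x y ^ 2 =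
      ENNReal.ofReal ((1 - ε ^ 2)⁻¹ * √v * Real.exp (ε ^ 2 * x ^ 2 / (1 + ε ^ 2))) *
        gaussianPDF (2 * ε * x / (1 + ε ^ 2)) v.toNNReal y := by
    intro y
    unfold gaussianPDF mehler gaussianPDFReal
    rw [← ENNReal.ofReal_pow (by positivity), ← ENNReal.ofReal_mul (by positivity),
      ← ENNReal.ofReal_mul (by positivity), Real.coe_toNNReal _ hv0.le,
      Real.sqrt_mul (by positivity) v]
    congr 1
    have hs : √v ≠ 0 := by positivity
    rw [mul_pow, inv_pow, Real.sq_sqrt h.le, ← Real.exp_nat_mul,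
      show ∀ a b c d : ℝ, a * b * (c * d) = a * c * (b * d) by intros; ring,
      show ∀ a b c d e : ℝ, a * b * c * (d * e) = (a * (b * d)) * (c * e) by intros; ring,
      ← Real.exp_add, ← Real.exp_add]
    congr 1
    · simp only [NNReal.coe_one, mul_one]
      field_simp
    · congr 1
      simp only [NNReal.coe_one]
      rw [hv]
      push_cast
      field_simp
      ring
  rw [gaussianReal_of_var_ne_zero _ one_ne_zero,
    lintegral_withDensity_eq_lintegral_mul _ (measurable_gaussianPDF _ _) (by fun_prop)]
  simp only [Pi.mul_apply, key]
  rw [lintegral_const_mul _ (measurable_gaussianPDF _ _),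
    lintegral_gaussianPDF_eq_one _ (by simpa using hv0), mul_one]

/-- The remaining exponential in `x` changes the standard Gaussian into one of variance `v⁻¹`; the
factors `√v` and `√v⁻¹` cancel. The value is `1 + χ²` of one correlated pair. -/
lemma lintegral_lintegral_mehler_sq {ε : ℝ} (hε : |ε| < 1) :
    ∫⁻ x, ∫⁻ y, mehler ε x y ^ 2 ∂(gaussianReal 0 1) ∂(gaussianReal 0 1) =
      ENNReal.ofReal (1 - ε ^ 2)⁻¹ := by
  have h := one_sub_sq_pos hε
  simp_rw [lintegral_mehler_sq hε]
  set v := (1 - ε ^ 2) / (1 + ε ^ 2) with hv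
  have hv0 : 0 < v := by positivity
  have key : ∀ x, gaussianPDF 0 1 x *
      ENNReal.ofReal ((1 - ε ^ 2)⁻¹ * √v * Real.exp (ε ^ 2 * x ^ 2 / (1 + ε ^ 2))) =
      ENNReal.ofReal (1 - ε ^ 2)⁻¹ * gaussianPDF 0 v⁻¹.toNNReal x := by
    intro x
    unfold gaussianPDF gaussianPDFReal
    rw [← ENNReal.ofReal_mul (by positivity), ← ENNReal.ofReal_mul (by positivity),
      Real.coe_toNNReal _ (by positivity), Real.sqrt_mul (by positivity) v⁻¹, Real.sqrt_inv]
    congr 1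
    have hs : √v ≠ 0 := by positivity
    rw [show ∀ a b c d e : ℝ, a * b * (c * d * e) = a * c * d * (b * e) by intros; ring,
      ← Real.exp_add, ← mul_assoc]
    congr 1
    · simp only [NNReal.coe_one, mul_one]
      field_simp
    · congr 1
      simp only [NNReal.coe_one]
      rw [hv]
      field_simp
      ring
  rw [gaussianReal_of_var_ne_zero _ one_ne_zero,
    lintegral_withDensity_eq_lintegral_mul _ (measurable_gaussianPDF _ _) (by fun_prop)]
  simp only [Pi.mul_apply, key]
  rw [lintegral_const_mul _ (measurable_gaussianPDF _ _),
    lintegral_gaussianPDF_eq_one _ (by simpa using hv0), mul_one]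

/-! ### Integration against a product of standard Gaussian measures -/

/-- The law of a family of independent standard Gaussian variables. -/
noncomputable abbrev stdPi (κ : Type*) [Fintype κ] : Measure (κ → ℝ) :=
  Measure.pi fun _ => gaussianReal 0 1

lemma measurable_lintegral_update {κ : Type*} [DecidableEq κ] {f : (κ → ℝ) → ℝ≥0∞} (hf : Measurable f) (b : κ) :
    Measurable fun x => ∫⁻ y, f (Function.update x b y) ∂(gaussianReal 0 1) :=
  Measurable.lintegral_prod_right' (f := fun z : (κ → ℝ) × ℝ => f (Function.update z.1 b z.2))
    (hf.comp measurable_update')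

variable {κ : Type*} [Fintype κ] [DecidableEq κ]

/-- Resampling one coordinate. -/
lemma lintegral_stdPi_update {f : (κ → ℝ) → ℝ≥0∞} (hf : Measurable f) (b : κ) :
    ∫⁻ x, f x ∂(stdPi κ) =
      ∫⁻ x, ∫⁻ y, f (Function.update x b y) ∂(gaussianReal 0 1) ∂(stdPi κ) := by
  refine lintegral_eq_of_lmarginal_eq {b} hf (measurable_lintegral_update hf b) ?_
  simp_rw [lmarginal_singleton]
  ext x
  simp

/-- The shear makes coordinate `b` correlated with `a`. Only `b` is resampled, so the claim reduces
to the conditional law of one coordinate. -/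
lemma lintegral_comp_shear {ε : ℝ} (hε : |ε| < 1) {a b : κ} (hab : a ≠ b)
    {f : (κ → ℝ) → ℝ≥0∞} (hf : Measurable f) :
    ∫⁻ x, f (Function.update x b (ε * x a + √(1 - ε ^ 2) * x b)) ∂(stdPi κ) =
      ∫⁻ x, f x * mehler ε (x a) (x b) ∂(stdPi κ) := by
  have h1 : Measurable fun x : κ → ℝ =>
      f (Function.update x b (ε * x a + √(1 - ε ^ 2) * x b)) :=
    hf.comp (measurable_update'.comp (f := fun x : κ → ℝ => (x, ε * x a + √(1 - ε ^ 2) * x b))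
      (by fun_prop))
  rw [lintegral_stdPi_update h1 b, lintegral_stdPi_update (b := b)
    (f := fun x => f x * mehler ε (x a) (x b)) (by fun_prop)]
  congr 1
  ext x
  simp only [Function.update_idem, Function.update_self, Function.update_of_ne hab]
  exact (lintegral_mul_mehler hε (x a) (hf.comp (measurable_update x))).symm

/-- The kernel has integral one in `x b`, so it disappears as soon as nothing else depends on that
end. All orthogonality below rests on this. -/
lemma lintegral_mul_mehler_right {ε : ℝ} (hε : |ε| < 1) {a b : κ} (hab : a ≠ b)
    {D : (κ → ℝ) → ℝ≥0∞} (hD : Measurable D) (hDb : ∀ x y, D (Function.update x b y) = D x) :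
    ∫⁻ x, D x * mehler ε (x a) (x b) ∂(stdPi κ) = ∫⁻ x, D x ∂(stdPi κ) := by
  rw [← lintegral_comp_shear hε hab hD]
  simp only [hDb]

lemma lintegral_mul_mehler_left {ε : ℝ} (hε : |ε| < 1) {a b : κ} (hab : a ≠ b)
    {D : (κ → ℝ) → ℝ≥0∞} (hD : Measurable D) (hDa : ∀ x y, D (Function.update x a y) = D x) :
    ∫⁻ x, D x * mehler ε (x a) (x b) ∂(stdPi κ) = ∫⁻ x, D x ∂(stdPi κ) := by
  simp_rw [fun x : κ → ℝ => mehler_comm ε (x a) (x b)]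
  exact lintegral_mul_mehler_right hε hab.symm hD hDa

lemma lintegral_mul_mehler_sq {ε : ℝ} (hε : |ε| < 1) {a b : κ} (hab : a ≠ b)
    {D : (κ → ℝ) → ℝ≥0∞} (hD : Measurable D) (hDa : ∀ x y, D (Function.update x a y) = D x)
    (hDb : ∀ x y, D (Function.update x b y) = D x) :
    ∫⁻ x, D x * mehler ε (x a) (x b) ^ 2 ∂(stdPi κ) =
      (∫⁻ x, D x ∂(stdPi κ)) * ENNReal.ofReal (1 - ε ^ 2)⁻¹ := by
  have hm : Measurable fun x => ∫⁻ y, mehler ε x y ^ 2 ∂(gaussianReal 0 1) :=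
    Measurable.lintegral_prod_right' (f := fun z : ℝ × ℝ => mehler ε z.1 z.2 ^ 2) (by fun_prop)
  rw [lintegral_stdPi_update (b := b) (by fun_prop)]
  simp only [hDb, Function.update_self, Function.update_of_ne hab]
  have h1 : ∀ x : κ → ℝ, ∫⁻ y, D x * mehler ε (x a) y ^ 2 ∂(gaussianReal 0 1) =
      D x * ∫⁻ y, mehler ε (x a) y ^ 2 ∂(gaussianReal 0 1) := fun x =>
    lintegral_const_mul _ (by fun_prop)
  simp_rw [h1]
  rw [lintegral_stdPi_update (b := a)
    (f := fun x => D x * ∫⁻ y, mehler ε (x a) y ^ 2 ∂(gaussianReal 0 1))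
    (hD.mul (hm.comp (measurable_pi_apply a)))]
  simp only [hDa, Function.update_self]
  simp_rw [lintegral_const_mul _ hm, lintegral_lintegral_mehler_sq hε]
  rw [lintegral_mul_const _ hD]

/-- Two correlated pairs that do not coincide are uncorrelated as perturbations. -/
lemma lintegral_mul_mehler_mul_mehler {ε : ℝ} (hε : |ε| < 1) {a b a' b' : κ}
    (h₁ : a ≠ b) (h₂ : a ≠ b') (h₃ : a' ≠ b) (h₄ : a' ≠ b')
    {D : (κ → ℝ) → ℝ≥0∞} (hD : Measurable D) (hDa : ∀ x y, D (Function.update x a y) = D x)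
    (hDb : ∀ x y, D (Function.update x b y) = D x)
    (hDb' : ∀ x y, D (Function.update x b' y) = D x) :
    ∫⁻ x, D x * (mehler ε (x a) (x b) * mehler ε (x a') (x b')) ∂(stdPi κ) =
      (∫⁻ x, D x ∂(stdPi κ)) *
        if a = a' ∧ b = b' then ENNReal.ofReal (1 - ε ^ 2)⁻¹ else 1 := by
  by_cases hb : b = b'
  · subst hb
    by_cases ha : a = a'
    · subst ha
      simpa [sq] using lintegral_mul_mehler_sq hε h₁ hD hDa hDb
    -- A common right end: `a` occurs in one kernel only, which is integrated out along `a`; then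
    -- `b` is free in the other kernel.
    · rw [show (fun x : κ → ℝ => D x * (mehler ε (x a) (x b) * mehler ε (x a') (x b))) =
        fun x => D x * mehler ε (x a') (x b) * mehler ε (x a) (x b) by ext; ring,
        lintegral_mul_mehler_left (D := fun x => D x * mehler ε (x a') (x b)) hε h₁
        (by fun_prop) (fun x y => by
          rw [hDa, Function.update_of_ne (Ne.symm ha), Function.update_of_ne h₁.symm]),
        lintegral_mul_mehler_right hε h₃ hD hDb]
      simp [ha]
  -- Different right ends: each kernel is integrated out along its own right end, whether or not the
  -- left ends agree.
  · rw [show (fun x : κ → ℝ => D x * (mehler ε (x a) (x b) * mehler ε (x a') (x b'))) =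
        fun x => D x * mehler ε (x a') (x b') * mehler ε (x a) (x b) by ext; ring,
        lintegral_mul_mehler_right (D := fun x => D x * mehler ε (x a') (x b')) hε h₁
        (by fun_prop) (fun x y => by
          rw [hDb, Function.update_of_ne h₃, Function.update_of_ne (Ne.symm hb)]),
        lintegral_mul_mehler_right hε h₄ hD hDb']
    simp [hb]

/-- The scalar product of the densities of two families of correlated pairs. -/
lemma lintegral_prod_mehler_mul_mehler {ι : Type*} [DecidableEq ι] {ε : ℝ} (hε : |ε| < 1)
    {a b a' b' : ι → κ} (G : Finset ι)
    (hab : ∀ g h, a g ≠ b h) (hab' : ∀ g h, a g ≠ b' h)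
    (hba : ∀ g h, a' g ≠ b h) (hba' : ∀ g h, a' g ≠ b' h)
    (haa : ∀ g h, g ≠ h → a g ≠ a h) (haa' : ∀ g h, g ≠ h → a g ≠ a' h)
    (hbb : ∀ g h, g ≠ h → b g ≠ b h) (hbb' : ∀ g h, g ≠ h → b g ≠ b' h)
    (hb'b' : ∀ g h, g ≠ h → b' g ≠ b' h) :
    ∫⁻ x, ∏ g ∈ G, (mehler ε (x (a g)) (x (b g)) * mehler ε (x (a' g)) (x (b' g))) ∂(stdPi κ) =
      ∏ g ∈ G, if a g = a' g ∧ b g = b' g then ENNReal.ofReal (1 - ε ^ 2)⁻¹ else 1 := by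
  induction G using Finset.induction_on with
  | empty => simp
  | insert g G hg ih =>
    rw [Finset.prod_insert hg, ← ih]
    simp_rw [Finset.prod_insert hg, mul_comm _ (∏ h ∈ G, _)]
    have hne : ∀ h ∈ G, g ≠ h := fun h hh e => hg (e ▸ hh)
    rw [lintegral_mul_mehler_mul_mehler hε (hab g g) (hab' g g) (hba g g) (hba' g g)
      (Finset.measurable_prod _ fun h _ => by fun_prop)]
    · exact mul_comm _ _
    · intro x y
      refine Finset.prod_congr rfl fun h hh => ?_
      rw [Function.update_of_ne (haa g h (hne h hh)).symm, Function.update_of_ne (hab g h).symm,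
        Function.update_of_ne (haa' g h (hne h hh)).symm, Function.update_of_ne (hab' g h).symm]
    · intro x y
      refine Finset.prod_congr rfl fun h hh => ?_
      rw [Function.update_of_ne (hab h g), Function.update_of_ne (hbb g h (hne h hh)).symm,
        Function.update_of_ne (hba h g), Function.update_of_ne (hbb' g h (hne h hh)).symm]
    · intro x y
      refine Finset.prod_congr rfl fun h hh => ?_
      rw [Function.update_of_ne (hab' h g), Function.update_of_ne (hbb' h g (hne h hh).symm),
        Function.update_of_ne (hba' h g), Function.update_of_ne (hb'b' g h (hne h hh)).symm]

/-! ### Gaussian vectors with finitely many disjoint correlated pairs of coordinates -/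

section Injective

variable {κ ι : Type*} {a b : ι → κ}

/-- Injectivity of `Sum.elim a b` encodes that all ends of all pairs are distinct. -/
lemma left_ne_right (h : Function.Injective (Sum.elim a b)) (g g' : ι) : a g ≠ b g' :=
  fun e => by simpa using @h (Sum.inl g) (Sum.inr g') e

lemma left_ne_left (h : Function.Injective (Sum.elim a b)) {g g' : ι} (hg : g ≠ g') :
    a g ≠ a g' :=
  fun e => hg (by simpa using @h (Sum.inl g) (Sum.inl g') e)

lemma right_ne_right (h : Function.Injective (Sum.elim a b)) {g g' : ι} (hg : g ≠ g') :
    b g ≠ b g' :=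
  fun e => hg (by simpa using @h (Sum.inr g) (Sum.inr g') e)

end Injective

section Pairs

open Matrix

variable {κ ι : Type*} [DecidableEq κ]

/-- The correlation matrix with entries `ε` at the positions of the pairs `(a g, b g)`, `g ∈ G`,
and zeros elsewhere off the diagonal. -/
noncomputable def pairCov (ε : ℝ) (a b : ι → κ) (G : Finset ι) : Matrix κ κ ℝ :=
  1 + ∑ g ∈ G, (single (a g) (b g) ε + single (b g) (a g) ε)

/-- A square root of `pairCov`, up to transposition. -/
noncomputable def pairRoot (ε : ℝ) (a b : ι → κ) (G : Finset ι) : Matrix κ κ ℝ :=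
  1 + ∑ g ∈ G, (single (b g) (a g) ε + single (b g) (b g) (√(1 - ε ^ 2) - 1))

variable {ε : ℝ} {a b : ι → κ}

lemma pairRoot_insert [DecidableEq ι] {g : ι} {G : Finset ι} (hg : g ∉ G) :
    pairRoot ε a b (insert g G) = pairRoot ε a b G +
      (single (b g) (a g) ε + single (b g) (b g) (√(1 - ε ^ 2) - 1)) := by
  rw [pairRoot, pairRoot, Finset.sum_insert hg]
  abel

variable [Fintype κ]

lemma pairRoot_mulVec_apply_of_ne {G : Finset ι} {j : κ} (hj : ∀ g ∈ G, j ≠ b g) (x : κ → ℝ) :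
    (pairRoot ε a b G *ᵥ x) j = x j := by
  have : ∀ k, pairRoot ε a b G j k = (1 : Matrix κ κ ℝ) j k := by
    intro k
    rw [pairRoot, Matrix.add_apply, Matrix.sum_apply, Finset.sum_eq_zero, add_zero]
    intro g hg
    simp [Matrix.add_apply, (hj g hg).symm]
  simp [mulVec, dotProduct, this, Matrix.one_apply]

variable [DecidableEq ι]

/-- The perturbations of different pairs annihilate each other in the products, so each pair can be
treated alone. -/
lemma pairRoot_mul_transpose (hε : |ε| < 1) (h : Function.Injective (Sum.elim a b))
    (G : Finset ι) : pairRoot ε a b G * (pairRoot ε a b G)ᵀ = pairCov ε a b G := by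
  have hr : √(1 - ε ^ 2) * √(1 - ε ^ 2) = 1 - ε ^ 2 :=
    Real.mul_self_sqrt (one_sub_sq_pos hε).le
  induction G using Finset.induction_on with
  | empty => simp [pairRoot, pairCov]
  | insert g G hg ih =>
    set N := single (b g) (a g) ε + single (b g) (b g) (√(1 - ε ^ 2) - 1) with hN
    have h1 : N * (pairRoot ε a b G)ᵀ = N := by
      rw [pairRoot, transpose_add, transpose_one, mul_add, mul_one, transpose_sum,
        Finset.mul_sum, Finset.sum_eq_zero, add_zero]
      intro g' hg'
      have hne : g ≠ g' := fun e => hg (e ▸ hg')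
      simp only [hN, transpose_add, transpose_single, add_mul, mul_add]
      simp [single_mul_single_of_ne, left_ne_left h hne, right_ne_right h hne, left_ne_right h,
        (left_ne_right h _ _).symm]
    have h2 : pairRoot ε a b G * Nᵀ = Nᵀ := by
      rw [← transpose_inj, transpose_mul, transpose_transpose, h1]
    have h3 : N + Nᵀ + N * Nᵀ = single (a g) (b g) ε + single (b g) (a g) ε := by
      simp only [hN, transpose_add, transpose_single, add_mul, mul_add, single_mul_single_same]
      rw [single_mul_single_of_ne _ _ _ _ (left_ne_right h _ _),
        single_mul_single_of_ne _ _ _ _ (left_ne_right h _ _).symm]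
      -- With `r = √(1 - ε²)` the diagonal contribution is `2(r - 1) + ε² + (r - 1)² = r² - 1 + ε² =
      -- 0`.
      have : (single (b g) (b g) (√(1 - ε ^ 2) - 1) + single (b g) (b g) (√(1 - ε ^ 2) - 1) +
          (single (b g) (b g) (ε * ε) +
            single (b g) (b g) ((√(1 - ε ^ 2) - 1) * (√(1 - ε ^ 2) - 1))) :
              Matrix κ κ ℝ) = 0 := by
        simp only [← single_add]
        convert single_zero (b g) (b g) using 2
        linear_combination hr
      refine Eq.trans ?_ (add_eq_left.2 this)
      abel
    rw [pairRoot_insert hg, transpose_add, add_mul, mul_add, mul_add, ih, ← hN, h1, h2,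
      pairCov, pairCov, Finset.sum_insert hg, ← h3]
    abel

lemma pairCov_posSemidef (hε : |ε| < 1) (h : Function.Injective (Sum.elim a b)) (G : Finset ι) :
    (pairCov ε a b G).PosSemidef := by
  rw [← pairRoot_mul_transpose hε h G]
  simpa using posSemidef_self_mul_conjTranspose (pairRoot ε a b G)

/-- The square root is a composition of shears, one for each pair; this permits adding the pairs to
the density one at a time. -/
lemma pairRoot_insert_mulVec (h : Function.Injective (Sum.elim a b)) {g : ι} {G : Finset ι}
    (hg : g ∉ G) (x : κ → ℝ) :
    pairRoot ε a b (insert g G) *ᵥ x = pairRoot ε a b G *ᵥ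
      Function.update x (b g) (ε * x (a g) + √(1 - ε ^ 2) * x (b g)) := by
  set N := single (b g) (a g) ε + single (b g) (b g) (√(1 - ε ^ 2) - 1) with hN
  have h1 : pairRoot ε a b G * N = N := by
    rw [pairRoot, add_mul, one_mul, Finset.sum_mul, Finset.sum_eq_zero, add_zero]
    intro g' hg'
    have hne : g ≠ g' := fun e => hg (e ▸ hg')
    simp only [hN, add_mul, mul_add]
    simp [single_mul_single_of_ne, right_ne_right h hne.symm, left_ne_right h]
  have h2 : (1 + N) *ᵥ x =
      Function.update x (b g) (ε * x (a g) + √(1 - ε ^ 2) * x (b g)) := by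
    ext j
    rw [add_mulVec, one_mulVec, hN, add_mulVec, single_mulVec, single_mulVec]
    by_cases hj : j = b g
    · subst hj
      simp
      ring
    · simp [hj]
  rw [← h2, mulVec_mulVec, mul_add, h1, mul_one, pairRoot_insert hg]

/-- The density of the law of a vector with correlated pairs. -/
lemma lintegral_comp_pairRoot (hε : |ε| < 1) (h : Function.Injective (Sum.elim a b))
    (G : Finset ι) {f : (κ → ℝ) → ℝ≥0∞} (hf : Measurable f) :
    ∫⁻ x, f (pairRoot ε a b G *ᵥ x) ∂(stdPi κ) =
      ∫⁻ x, f x * ∏ g ∈ G, mehler ε (x (a g)) (x (b g)) ∂(stdPi κ) := by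
  induction G using Finset.induction_on generalizing f with
  | empty => simp [pairRoot]
  | insert g G hg ih =>
    have hm : Measurable fun x : κ → ℝ => pairRoot ε a b G *ᵥ x :=
      (Continuous.matrix_mulVec continuous_const continuous_id).measurable
    simp_rw [pairRoot_insert_mulVec h hg]
    rw [lintegral_comp_shear (f := fun x => f (pairRoot ε a b G *ᵥ x)) hε (left_ne_right h g g)
      (hf.comp hm)]
    -- The old root fixes both ends of the new pair, so the new kernel can be absorbed into the
    -- function to which the induction hypothesis is applied.
    have h1 : ∀ x : κ → ℝ, f (pairRoot ε a b G *ᵥ x) * mehler ε (x (a g)) (x (b g)) =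
        (fun z : κ → ℝ => f z * mehler ε (z (a g)) (z (b g))) (pairRoot ε a b G *ᵥ x) := by
      intro x
      simp only
      rw [pairRoot_mulVec_apply_of_ne (fun _ _ => left_ne_right h _ _),
        pairRoot_mulVec_apply_of_ne
          (fun g' hg' => right_ne_right h (ne_of_mem_of_not_mem hg' hg).symm)]
    simp only [h1]
    rw [ih (f := fun z => f z * mehler ε (z (a g)) (z (b g))) (by fun_prop)]
    simp_rw [Finset.prod_insert hg, mul_assoc]

/-! ### Gaussian laws with the pair matrices, and their densities. -/

open WithLp

/-- The characteristic function sees `R` only through `R * Rᵀ`, so the explicit `pairRoot` may serve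
as the square root. -/
lemma multivariateGaussian_zero_eq_map (R S : Matrix κ κ ℝ) (hRS : R * Rᵀ = S) :
    multivariateGaussian 0 S =
      (stdGaussian (EuclideanSpace ℝ κ)).map (toEuclideanCLM (𝕜 := ℝ) R) := by
  have hS : S.PosSemidef := by
    rw [← hRS]
    simpa using posSemidef_self_mul_conjTranspose R
  apply Measure.ext_of_charFun
  ext t
  rw [charFun_multivariateGaussian hS, charFun_apply, integral_map (by fun_prop)
    (Measurable.aestronglyMeasurable (by fun_prop))]
  have h1 : ∀ x, inner ℝ (toEuclideanCLM (𝕜 := ℝ) R x) t =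
      inner ℝ x (toEuclideanCLM (𝕜 := ℝ) Rᵀ t) := by
    intro x
    rw [real_inner_comm, inner_toEuclideanCLM, inner_toEuclideanCLM, dotProduct_mulVec,
      ← mulVec_transpose, dotProduct_comm]
  simp_rw [h1, ← charFun_apply]
  rw [charFun_stdGaussian, ← Complex.ofReal_pow, ← real_inner_self_eq_norm_sq, inner_toEuclideanCLM, ← hRS]
  congr 1
  simp [dotProduct_mulVec, ← mulVec_mulVec, mulVec_transpose, neg_div]

lemma lintegral_multivariateGaussian_pairCov (hε : |ε| < 1)
    (h : Function.Injective (Sum.elim a b)) (G : Finset ι) (μ : EuclideanSpace ℝ κ)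
    {f : EuclideanSpace ℝ κ → ℝ≥0∞} (hf : Measurable f) :
    ∫⁻ x, f x ∂(multivariateGaussian μ (pairCov ε a b G)) =
      ∫⁻ x, f (μ + toLp 2 x) * ∏ g ∈ G, mehler ε (x (a g)) (x (b g)) ∂(stdPi κ) := by
  have h1 : multivariateGaussian μ (pairCov ε a b G) =
      (multivariateGaussian 0 (pairCov ε a b G)).map (fun x => μ + x) := by
    unfold multivariateGaussian
    rw [Measure.map_map (by fun_prop) (by fun_prop)]
    congr 1
    ext x
    simp
  rw [h1, multivariateGaussian_zero_eq_map _ _ (pairRoot_mul_transpose hε h G),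
    ← map_pi_eq_stdGaussian, Measure.map_map (by fun_prop) (by fun_prop),
    Measure.map_map (by fun_prop) (by fun_prop), lintegral_map hf (by fun_prop),
    ← lintegral_comp_pairRoot (f := fun x => f (μ + toLp 2 x)) hε h G (by fun_prop)]
  rfl

lemma lintegral_multivariateGaussian_one (μ : EuclideanSpace ℝ κ)
    {f : EuclideanSpace ℝ κ → ℝ≥0∞} (hf : Measurable f) :
    ∫⁻ x, f x ∂(multivariateGaussian μ (1 : Matrix κ κ ℝ)) =
      ∫⁻ x, f (μ + toLp 2 x) ∂(stdPi κ) := by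
  -- The identity matrix is the case of an empty family of pairs.
  have := lintegral_multivariateGaussian_pairCov (ε := 0) (a := Empty.elim) (b := Empty.elim)
    (by simp) (fun x => by rcases x with x | x <;> exact x.elim) ∅ μ hf
  simpa [pairCov] using this

lemma multivariateGaussian_pairCov_eq_withDensity (hε : |ε| < 1)
    (h : Function.Injective (Sum.elim a b)) (G : Finset ι) (μ : EuclideanSpace ℝ κ) :
    multivariateGaussian μ (pairCov ε a b G) =
      (multivariateGaussian μ 1).withDensity
        (fun x => ∏ g ∈ G, mehler ε (x (a g) - μ (a g)) (x (b g) - μ (b g))) := by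
  have hm : Measurable fun x : EuclideanSpace ℝ κ =>
      ∏ g ∈ G, mehler ε (x (a g) - μ (a g)) (x (b g) - μ (b g)) :=
    Finset.measurable_prod _ fun g _ => by fun_prop
  refine Measure.ext_of_lintegral _ fun f hf => ?_
  rw [lintegral_withDensity_eq_lintegral_mul _ hm hf, lintegral_multivariateGaussian_one _
    (hm.mul hf), lintegral_multivariateGaussian_pairCov hε h G μ hf]
  simp [mul_comm]

/-- The reference law keeps all other pairs, as needed for mixing, where one pair is removed at a
time. -/
lemma multivariateGaussian_pairCov_insert (hε : |ε| < 1)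
    (h : Function.Injective (Sum.elim a b)) {g : ι} {G : Finset ι} (hg : g ∉ G)
    (μ : EuclideanSpace ℝ κ) :
    multivariateGaussian μ (pairCov ε a b (insert g G)) =
      (multivariateGaussian μ (pairCov ε a b G)).withDensity
        (fun x => mehler ε (x (a g) - μ (a g)) (x (b g) - μ (b g))) := by
  have hm : ∀ g, Measurable fun x : EuclideanSpace ℝ κ =>
      mehler ε (x (a g) - μ (a g)) (x (b g) - μ (b g)) := fun g => by fun_prop
  rw [multivariateGaussian_pairCov_eq_withDensity hε h,
    multivariateGaussian_pairCov_eq_withDensity hε h,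
    ← withDensity_mul _ (Finset.measurable_prod _ fun g _ => hm g) (hm g)]
  congr 1
  ext x
  simp [Finset.prod_insert hg, mul_comm]

end Pairs

/-! ### Fourth moments of a Gaussian vector -/

lemma integral_pow_four_gaussianReal (v : NNReal) :
    ∫ x, x ^ 4 ∂(gaussianReal 0 v) = 3 * (v : ℝ) ^ 2 := by
  have h := iteratedDeriv_mgf_zero (X := id) (μ := gaussianReal 0 v)
    (by rw [integrableExpSet_id_gaussianReal]; simp) 4
  simp only [Pi.pow_apply, id_eq] at h
  rw [← h, mgf_id_gaussianReal]
  -- Derivatives of the moment generating function are polynomials times it. The first three have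
  -- degree at most three, and `e0`–`e3` restore the cubic form in which `hd` applies.
  have hd : ∀ (c₀ c₁ c₂ c₃ : ℝ), deriv (fun t : ℝ => (c₀ + c₁ * t + c₂ * t ^ 2 + c₃ * t ^ 3) *
      Real.exp (0 * t + v * t ^ 2 / 2)) = fun t : ℝ =>
      (c₁ + (2 * c₂ + v * c₀) * t + (3 * c₃ + v * c₁) * t ^ 2 + v * c₂ * t ^ 3 + v * c₃ * t ^ 4) *
        Real.exp (0 * t + v * t ^ 2 / 2) := by
    intro c₀ c₁ c₂ c₃
    ext t
    refine HasDerivAt.deriv ?_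
    have h1 : HasDerivAt (fun t : ℝ => 0 * t + v * t ^ 2 / 2) (v * t) t := by
      convert! ((hasDerivAt_id t).const_mul 0).add
        ((((hasDerivAt_id t).pow 2).const_mul (v : ℝ)).div_const 2) using 1
      simp
      ring
    have h2 : HasDerivAt (fun t : ℝ => c₀ + c₁ * t + c₂ * t ^ 2 + c₃ * t ^ 3)
        (c₁ + c₂ * (2 * t) + c₃ * (3 * t ^ 2)) t := by
      convert! ((((hasDerivAt_id t).const_mul c₁).const_add c₀).add
        (((hasDerivAt_id t).pow 2).const_mul c₂)).add
        (((hasDerivAt_id t).pow 3).const_mul c₃) using 1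
      simp
    convert! h2.mul h1.exp using 1
    ring
  have e0 : (fun t : ℝ => Real.exp (0 * t + v * t ^ 2 / 2)) = fun t : ℝ =>
      (1 + 0 * t + 0 * t ^ 2 + 0 * t ^ 3) * Real.exp (0 * t + v * t ^ 2 / 2) := by
    ext t; ring
  have e1 : (fun t : ℝ => ((0 : ℝ) + (2 * 0 + v * 1) * t + (3 * 0 + v * 0) * t ^ 2 +
      v * 0 * t ^ 3 + v * 0 * t ^ 4) * Real.exp (0 * t + v * t ^ 2 / 2)) = fun t : ℝ =>
      (0 + v * t + 0 * t ^ 2 + 0 * t ^ 3) * Real.exp (0 * t + v * t ^ 2 / 2) := by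
    ext t; ring
  have e2 : (fun t : ℝ => ((v : ℝ) + (2 * 0 + v * 0) * t + (3 * 0 + v * v) * t ^ 2 +
      v * 0 * t ^ 3 + v * 0 * t ^ 4) * Real.exp (0 * t + v * t ^ 2 / 2)) = fun t : ℝ =>
      (v + 0 * t + v ^ 2 * t ^ 2 + 0 * t ^ 3) * Real.exp (0 * t + v * t ^ 2 / 2) := by
    ext t; ring
  have e3 : (fun t : ℝ => ((0 : ℝ) + (2 * v ^ 2 + v * v) * t + (3 * 0 + v * 0) * t ^ 2 +
      v * v ^ 2 * t ^ 3 + v * 0 * t ^ 4) * Real.exp (0 * t + v * t ^ 2 / 2)) = fun t : ℝ =>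
      (0 + 3 * v ^ 2 * t + 0 * t ^ 2 + v ^ 3 * t ^ 3) * Real.exp (0 * t + v * t ^ 2 / 2) := by
    ext t; ring
  rw [iteratedDeriv_succ', iteratedDeriv_succ', iteratedDeriv_succ', iteratedDeriv_one,
    e0, hd, e1, hd, e2, hd, e3, hd]
  simp

lemma integrable_pow_four_gaussianReal (v : NNReal) :
    Integrable (fun x => x ^ 4) (gaussianReal 0 v) := by
  have := (memLp_id_gaussianReal (μ := 0) (v := v) 4).integrable_norm_pow (by norm_num)
  simpa [Even.pow_abs (show Even 4 by decide)] using this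

section Moments

open Matrix

variable {κ : Type*} [Fintype κ] [DecidableEq κ] {μ : EuclideanSpace ℝ κ} {S : Matrix κ κ ℝ}

lemma map_inner_sub_multivariateGaussian (hS : S.PosSemidef) (t : EuclideanSpace ℝ κ) :
    (multivariateGaussian μ S).map (fun x => inner ℝ t (x - μ)) =
      gaussianReal 0 (t ⬝ᵥ S *ᵥ t).toNNReal := by
  have h1 : (fun x => inner ℝ t (x - μ)) = (fun y => y - inner ℝ t μ) ∘ innerSL ℝ t := by
    ext x
    simp [inner_sub_right]
  rw [h1, ← Measure.map_map (by fun_prop) (by fun_prop), IsGaussian.map_eq_gaussianReal,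
    gaussianReal_map_sub_const]
  have h3 : ∫ x, innerSL ℝ t x ∂(multivariateGaussian μ S) = inner ℝ t μ := by
    have := (innerSL ℝ t).integral_comp_id_comm (μ := multivariateGaussian μ S)
      IsGaussian.integrable_id
    simpa using this
  have h2 : Var[innerSL ℝ t; multivariateGaussian μ S] = t ⬝ᵥ S *ᵥ t := by
    rw [← covarianceBilin_multivariateGaussian (μ := μ) hS,
      covarianceBilin_self IsGaussian.memLp_two_id]
    rfl
  rw [h2, h3, sub_self]

lemma integral_inner_pow_four (hS : S.PosSemidef) (t : EuclideanSpace ℝ κ) :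
    Integrable (fun x => (inner ℝ t (x - μ)) ^ 4) (multivariateGaussian μ S) ∧
    ∫ x, (inner ℝ t (x - μ)) ^ 4 ∂(multivariateGaussian μ S) = 3 * (t ⬝ᵥ S *ᵥ t) ^ 2 := by
  have hm : Measurable fun x : EuclideanSpace ℝ κ => inner ℝ t (x - μ) := by fun_prop
  have h0 : 0 ≤ t ⬝ᵥ S *ᵥ t := by simpa using hS.dotProduct_mulVec_nonneg t
  constructor
  · have := integrable_pow_four_gaussianReal (t ⬝ᵥ S *ᵥ t).toNNReal
    rw [← map_inner_sub_multivariateGaussian (μ := μ) hS] at this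
    exact this.comp_measurable hm
  · have := integral_pow_four_gaussianReal (t ⬝ᵥ S *ᵥ t).toNNReal
    rw [← map_inner_sub_multivariateGaussian (μ := μ) hS, integral_map (by fun_prop) (by fun_prop),
      Real.coe_toNNReal _ h0] at this
    exact this

/-- The mixed fourth moments of a Gaussian vector (Isserlis' theorem). -/
lemma integral_centred_mul_four (hS : S.PosSemidef) (i j l m : κ) :
    Integrable (fun x => (x i - μ i) * (x j - μ j) * ((x l - μ l) * (x m - μ m)))
      (multivariateGaussian μ S) ∧
    ∫ x, (x i - μ i) * (x j - μ j) * ((x l - μ l) * (x m - μ m)) ∂(multivariateGaussian μ S) =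
      S i j * S l m + S i l * S j m + S i m * S j l := by
  set t : ℝ → ℝ → ℝ → EuclideanSpace ℝ κ := fun r s u => EuclideanSpace.single i 1 +
    r • EuclideanSpace.single j 1 + s • EuclideanSpace.single l 1 +
    u • EuclideanSpace.single m 1 with ht
  have hsymm : ∀ i j, S i j = S j i := fun i j => by
    simpa using (hS.1.apply j i)
  have hin : ∀ r s u (x : EuclideanSpace ℝ κ), inner ℝ (t r s u) (x - μ) =
      (x i - μ i) + r * (x j - μ j) + s * (x l - μ l) + u * (x m - μ m) := by
    intro r s u x
    simp [ht, inner_add_left, inner_smul_left, EuclideanSpace.inner_single_left]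
  have hq : ∀ r s u, (t r s u) ⬝ᵥ S *ᵥ (t r s u) = S i i + r ^ 2 * S j j + s ^ 2 * S l l +
      u ^ 2 * S m m + 2 * (r * S i j + s * S i l + u * S i m + r * s * S j l + r * u * S j m +
        s * u * S l m) := by
    intro r s u
    simp only [ht, WithLp.ofLp_add, WithLp.ofLp_smul, PiLp.ofLp_single,
      add_dotProduct, mulVec_add, dotProduct_add, mulVec_smul, smul_dotProduct, dotProduct_smul,
      mulVec_single_one, single_one_dotProduct, Matrix.col_apply, smul_eq_mul]
    rw [hsymm j i, hsymm l i, hsymm m i, hsymm l j, hsymm m j, hsymm m l]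
    ring
  have hI := fun r s u => integral_inner_pow_four (μ := μ) hS (t r s u)
  simp only [hin, hq] at hI
  -- Polarization: the signed sum over eight sign patterns keeps only the mixed product, with
  -- coefficient `8 * 24 = 192`.
  have hpol : ∀ x : EuclideanSpace ℝ κ,
      (x i - μ i) * (x j - μ j) * ((x l - μ l) * (x m - μ m)) = (1 / 192) *
      (((x i - μ i) + 1 * (x j - μ j) + 1 * (x l - μ l) + 1 * (x m - μ m)) ^ 4
      - ((x i - μ i) + 1 * (x j - μ j) + 1 * (x l - μ l) + (-1) * (x m - μ m)) ^ 4
      - ((x i - μ i) + 1 * (x j - μ j) + (-1) * (x l - μ l) + 1 * (x m - μ m)) ^ 4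
      + ((x i - μ i) + 1 * (x j - μ j) + (-1) * (x l - μ l) + (-1) * (x m - μ m)) ^ 4
      - ((x i - μ i) + (-1) * (x j - μ j) + 1 * (x l - μ l) + 1 * (x m - μ m)) ^ 4
      + ((x i - μ i) + (-1) * (x j - μ j) + 1 * (x l - μ l) + (-1) * (x m - μ m)) ^ 4
      + ((x i - μ i) + (-1) * (x j - μ j) + (-1) * (x l - μ l) + 1 * (x m - μ m)) ^ 4
      - ((x i - μ i) + (-1) * (x j - μ j) + (-1) * (x l - μ l) + (-1) * (x m - μ m)) ^ 4) := by
    intro x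
    ring
  simp_rw [hpol]
  have i1 := (hI 1 1 1).1.sub (hI 1 1 (-1)).1
  have i2 := i1.sub (hI 1 (-1) 1).1
  have i3 := i2.add (hI 1 (-1) (-1)).1
  have i4 := i3.sub (hI (-1) 1 1).1
  have i5 := i4.add (hI (-1) 1 (-1)).1
  have i6 := i5.add (hI (-1) (-1) 1).1
  have i7 := i6.sub (hI (-1) (-1) (-1)).1
  refine ⟨i7.const_mul (1 / 192), ?_⟩
  rw [integral_const_mul]
  erw [integral_sub i6 (hI (-1) (-1) (-1)).1, integral_add i5 (hI (-1) (-1) 1).1,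
    integral_add i4 (hI (-1) 1 (-1)).1, integral_sub i3 (hI (-1) 1 1).1,
    integral_add i2 (hI 1 (-1) (-1)).1, integral_sub i1 (hI 1 (-1) 1).1,
    integral_sub (hI 1 1 1).1 (hI 1 1 (-1)).1]
  simp only [hI]
  ring

end Moments

/-! ### Gaussian vectors with weak correlations -/

section Weak

variable {p : ℕ} {μ : Vec p} {S : Matrix (Fin p) (Fin p) ℝ}

lemma covariance_centredProd (hS : S.PosSemidef) (i j l m : Fin p) :
    covariance (centredProd μ i j) (centredProd μ l m) (multivariateGaussian μ S) =
      S i l * S j m + S i m * S j l := by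
  have hmem : ∀ i j, MemLp (centredProd μ i j) 2 (multivariateGaussian μ S) := by
    intro i j
    have hm : Measurable (centredProd μ i j) := by
      unfold centredProd
      fun_prop
    refine (memLp_two_iff_integrable_sq hm.aestronglyMeasurable).2 ?_
    simpa [centredProd, sq] using (integral_centred_mul_four (μ := μ) hS i j i j).1
  have hmean : ∀ i j, (multivariateGaussian μ S)[centredProd μ i j] = S i j := by
    intro i j
    rw [← covariance_eval_multivariateGaussian (μ := μ) hS, covariance]
    have h : ∀ i, ∫ x : EuclideanSpace ℝ (Fin p), x i ∂(multivariateGaussian μ S) = μ i := by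
      intro i
      have := (EuclideanSpace.proj (𝕜 := ℝ) i).integral_comp_id_comm
        (μ := multivariateGaussian μ S) IsGaussian.integrable_id
      simpa using this
    simp [h, centredProd]
  rw [covariance_eq_sub (hmem i j) (hmem l m), hmean, hmean]
  have := (integral_centred_mul_four (μ := μ) hS i j l m).2
  simp only [Pi.mul_apply, centredProd]
  rw [this]
  ring

lemma theta_eq (hS : S.PosSemidef) (i j : Fin p) :
    theta μ S i j = S i i * S j j + S i j * S i j := by
  have hm : Measurable (centredProd μ i j) := by
    unfold centredProd
    fun_prop
  have hsymm : S j i = S i j := by simpa using hS.1.apply i j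
  rw [theta, ← covariance_self hm.aemeasurable, covariance_centredProd hS, hsymm]

lemma boundedVariances_of_diag {τ : ℝ} (hτ : τ ∈ Set.Ioo (0 : ℝ) 1) (hS : S.PosSemidef)
    (hd : ∀ i, S i i = 1) : BoundedVariances τ μ S where
  lower i := by rw [hd]; exact hτ.2
  upper i := by rw [hd]; exact (one_lt_inv₀ hτ.1).2 hτ.2
  prod i j := by
    rw [theta_eq hS, hd, hd]
    have := mul_self_nonneg (S i j)
    have := hτ.2
    simp only [mul_one, div_one]
    linarith

/-- For distinct unordered pairs, both terms of the covariance `S i l * S j m + S i m * S j l`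
contain an off-diagonal factor, so it is at most `2η`; the variances in the denominator are at least
one. -/
lemma boundedCorrelations_of_weak {ρ₀ η : ℝ} (hS : S.PosSemidef) (hd : ∀ i, S i i = 1)
    (hη₁ : η ≤ 1) (hη : 2 * η < 1 - ρ₀) (ho : ∀ i j, i ≠ j → |S i j| ≤ η) :
    BoundedCorrelations ρ₀ μ S where
  coord i j hij := by
    have := ho i j hij
    have := abs_nonneg (S i j)
    simp only [corr, hd, mul_one, Real.sqrt_one, div_one]
    linarith
  prod i j l m hij hlm hne := by
    have hle : ∀ i j, |S i j| ≤ 1 := by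
      intro i j
      by_cases h : i = j
      · simp [h, hd]
      · exact (ho i j h).trans hη₁
    have h1 : ∀ i j l m, i ≠ j ∨ l ≠ m → |S i j * S l m| ≤ η := by
      intro i j l m h
      rw [abs_mul]
      rcases h with h | h
      · exact (mul_le_mul (ho i j h) (hle l m) (abs_nonneg _)
          ((abs_nonneg _).trans (ho i j h))).trans (mul_one η).le
      · exact (mul_le_mul (hle i j) (ho l m h) (abs_nonneg _) zero_le_one).trans (one_mul η).le
    have h2 : |S i l * S j m| ≤ η := by
      apply h1
      by_contra! h
      exact hne (by rw [h.1, h.2])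
    -- Two diagonal factors would mean `i = m` and `j = l`; then the orderings `i ≤ j` and `l ≤ m`
    -- force all four indices to agree.
    have h3 : |S i m * S j l| ≤ η := by
      apply h1
      by_contra! h
      obtain ⟨rfl, rfl⟩ := h
      exact hne (by rw [le_antisymm hij hlm])
    have h4 : ∀ i j, 1 ≤ theta μ S i j := by
      intro i j
      rw [theta_eq hS, hd, hd]
      have := mul_self_nonneg (S i j)
      linarith
    have h5 : 1 ≤ √(theta μ S i j * theta μ S l m) := by
      rw [Real.one_le_sqrt]
      exact one_le_mul_of_one_le_of_one_le (h4 _ _) (h4 _ _)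
    rw [prodCorr, covariance_centredProd hS, abs_div, abs_of_nonneg (Real.sqrt_nonneg _)]
    refine (div_le_self (abs_nonneg _) h5).trans_lt ?_
    have := abs_add_le (S i l * S j m) (S i m * S j l)
    linarith

end Weak

/-! ### Second moments of densities and total variation -/

/-- A density with second moment at most `1 + χ` is `√χ`-close to `1` in mean. -/
lemma lintegral_sub_one_le {Ω : Type*} {_ : MeasurableSpace Ω} {Q : Measure Ω}
    [IsProbabilityMeasure Q] {d : Ω → ℝ≥0∞} (hd : Measurable d) (h1 : ∫⁻ x, d x ∂Q = 1)
    {χ : ℝ} (hχ : 0 ≤ χ) (h2 : ∫⁻ x, d x ^ 2 ∂Q ≤ ENNReal.ofReal (1 + χ)) :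
    ∫⁻ x, (d x - 1) ∂Q ≤ ENNReal.ofReal √χ := by
  -- Subtraction is truncated, so `d x - 1` is a positive part; the inequality is `((d - 1)⁺)² ≤ (d
  -- - 1)²` with the negative term moved across.
  have hpt : ∀ x, (d x - 1) ^ 2 + 2 * d x ≤ d x ^ 2 + 1 := by
    intro x
    induction hx : d x with
    | top => simp
    | coe y =>
      rw [show (1 : ℝ≥0∞) = ((1 : NNReal) : ℝ≥0∞) from rfl,
        show (2 : ℝ≥0∞) = ((2 : NNReal) : ℝ≥0∞) from rfl]
      norm_cast
      rw [← NNReal.coe_le_coe]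
      push_cast
      rcases le_total y 1 with h | h
      · rw [tsub_eq_zero_of_le h]
        push_cast
        nlinarith [sq_nonneg ((y : ℝ) - 1)]
      · rw [NNReal.coe_sub h]
        push_cast
        nlinarith
  have hF : ∫⁻ x, (d x - 1) ^ 2 ∂Q ≤ ENNReal.ofReal χ := by
    have := lintegral_mono (μ := Q) hpt
    rw [lintegral_add_right _ (by fun_prop), lintegral_const_mul _ hd, h1,
      lintegral_add_right _ measurable_const] at this
    have h3 : ∫⁻ x, (d x - 1) ^ 2 ∂Q + 2 ≤ ENNReal.ofReal χ + 2 := by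
      refine (this.trans (le_of_eq_of_le (by simp) (add_le_add_left h2 1))).trans ?_ |>.trans' ?_
      · rw [add_comm (1 : ℝ) χ, ENNReal.ofReal_add hχ zero_le_one, add_assoc]
        norm_num
      · simp
    exact (ENNReal.add_le_add_iff_right (by norm_num)).1 h3
  -- Cauchy–Schwarz against the constant function one.
  have hH := ENNReal.lintegral_mul_le_Lp_mul_Lq Q Real.HolderConjugate.two_two
    (f := fun x => d x - 1) (g := 1) (hd.sub measurable_const).aemeasurable
    measurable_one.aemeasurable
  simp only [Pi.mul_apply, Pi.one_apply, mul_one, ENNReal.rpow_ofNat, one_pow, lintegral_one,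
    measure_univ, ENNReal.one_rpow] at hH
  refine hH.trans ?_
  rw [Real.sqrt_eq_rpow, ← ENNReal.ofReal_rpow_of_nonneg hχ (by norm_num)]
  gcongr

lemma sum_measureReal_inter {Ω : Type*} {m0 : MeasurableSpace Ω} (ν : Measure Ω)
    [IsFiniteMeasure ν] {𝓐 𝓑 : MeasurableSpace Ω} (h𝓐 : 𝓐 ≤ m0) (h𝓑 : 𝓑 ≤ m0) {u₁ u₂ : ℕ}
    {A : Fin u₁ → Set Ω} {B : Fin u₂ → Set Ω} (hA : IsFinPartition 𝓐 A)
    (hB : IsFinPartition 𝓑 B) :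
    ∑ l₁, ∑ l₂, ν.real (A l₁ ∩ B l₂) = ν.real Set.univ := by
  have h1 : ∀ s, MeasurableSet[m0] s → ∑ l₂, ν.real (s ∩ B l₂) = ν.real s := by
    intro s hs
    rw [← measureReal_iUnion_fintype (fun i j hij => ((hB.disjoint hij).inter_left' s).inter_right' s)
      (fun i => hs.inter (h𝓑 _ (hB.measurable i))), ← Set.inter_iUnion, hB.cover, Set.inter_univ]
  simp_rw [fun l => h1 _ (h𝓐 _ (hA.measurable l))]
  rw [← measureReal_iUnion_fintype hA.disjoint (fun i => h𝓐 _ (hA.measurable i)), hA.cover]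

/-- Comparison with a law under which the two `σ`-fields are independent. -/
lemma betaCoeff_withDensity_le {Ω : Type*} {m0 : MeasurableSpace Ω} {P Q : Measure Ω}
    [IsProbabilityMeasure P] [IsProbabilityMeasure Q] {d : Ω → ℝ≥0∞}
    (hP : P = Q.withDensity d) {𝓐 𝓑 : MeasurableSpace Ω} (h𝓐 : 𝓐 ≤ m0) (h𝓑 : 𝓑 ≤ m0)
    (hA : ∀ s, MeasurableSet[𝓐] s → P s = Q s) (hB : ∀ s, MeasurableSet[𝓑] s → P s = Q s)
    (hind : Indep 𝓐 𝓑 Q) : betaCoeff P 𝓐 𝓑 ≤ ∫⁻ x, (d x - 1) ∂Q := by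
  have hint : ∫⁻ x, d x ∂Q = 1 := by
    rw [← setLIntegral_univ, ← withDensity_apply _ MeasurableSet.univ, ← hP, measure_univ]
  have hfin : ∫⁻ x, (d x - 1) ∂Q ≠ ⊤ :=
    ((lintegral_mono fun x => tsub_le_self).trans_lt (hint ▸ ENNReal.one_lt_top)).ne
  set ν := Q.withDensity (fun x => d x - 1) with hν
  have : IsFiniteMeasure ν := isFiniteMeasure_withDensity hfin
  have hνuniv : ν.real Set.univ = (∫⁻ x, (d x - 1) ∂Q).toReal := by
    rw [Measure.real, hν, withDensity_apply _ MeasurableSet.univ, setLIntegral_univ]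
  refine iSup_le fun u₁ => iSup_le fun u₂ => iSup_le fun A => iSup_le fun B =>
    iSup_le fun pA => iSup_le fun pB => ?_
  rw [← ENNReal.ofReal_toReal hfin]
  refine ENNReal.ofReal_le_ofReal ?_
  -- This is `|u| = 2u⁺ - u` with `u = P - Q` on a cell, where `ν` dominates `u⁺`. Summed over all
  -- cells, `u` vanishes and the `2` cancels the `1/2` of the coefficient.
  have hx : ∀ l₁ l₂, |P.real (A l₁ ∩ B l₂) - P.real (A l₁) * P.real (B l₂)| ≤
      2 * ν.real (A l₁ ∩ B l₂) - (P.real (A l₁ ∩ B l₂) - Q.real (A l₁ ∩ B l₂)) := by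
    intro l₁ l₂
    have e1 : P.real (A l₁) * P.real (B l₂) = Q.real (A l₁ ∩ B l₂) := by
      rw [Measure.real, Measure.real, Measure.real, hA _ (pA.measurable l₁),
        hB _ (pB.measurable l₂), ← ENNReal.toReal_mul,
        (Indep_iff 𝓐 𝓑 Q).1 hind _ _ (pA.measurable l₁) (pB.measurable l₂)]
    have hC : MeasurableSet[m0] (A l₁ ∩ B l₂) :=
      (h𝓐 _ (pA.measurable l₁)).inter (h𝓑 _ (pB.measurable l₂))
    have e2 : P.real (A l₁ ∩ B l₂) ≤ Q.real (A l₁ ∩ B l₂) + ν.real (A l₁ ∩ B l₂) := by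
      rw [Measure.real, Measure.real, Measure.real,
        ← ENNReal.toReal_add (measure_ne_top _ _) (measure_ne_top _ _)]
      refine ENNReal.toReal_mono (by finiteness) ?_
      rw [hP, hν, withDensity_apply _ hC, withDensity_apply _ hC, ← setLIntegral_one,
        ← lintegral_add_left measurable_const]
      exact lintegral_mono fun x => le_add_tsub
    have e3 : 0 ≤ ν.real (A l₁ ∩ B l₂) := measureReal_nonneg
    rw [e1, abs_le]
    constructor <;> linarith
  have hsum := Finset.sum_le_sum fun l₁ (_ : l₁ ∈ Finset.univ) =>
    Finset.sum_le_sum fun l₂ (_ : l₂ ∈ Finset.univ) => hx l₁ l₂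
  simp only [Finset.sum_sub_distrib, ← Finset.mul_sum] at hsum
  rw [sum_measureReal_inter ν h𝓐 h𝓑 pA pB, sum_measureReal_inter P h𝓐 h𝓑 pA pB,
    sum_measureReal_inter Q h𝓐 h𝓑 pA pB, hνuniv] at hsum
  simp only [probReal_univ, sub_self, sub_zero] at hsum
  linarith

lemma betaCoeff_eq_zero_of_indep {Ω : Type*} {m0 : MeasurableSpace Ω} {P : Measure Ω}
    [IsProbabilityMeasure P] {𝓐 𝓑 : MeasurableSpace Ω} (h𝓐 : 𝓐 ≤ m0) (h𝓑 : 𝓑 ≤ m0)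
    (hind : Indep 𝓐 𝓑 P) : betaCoeff P 𝓐 𝓑 = 0 := by
  have := betaCoeff_withDensity_le (P := P) (Q := P) (d := fun _ => 1)
    withDensity_one.symm h𝓐 h𝓑 (fun _ _ => rfl) (fun _ _ => rfl) hind
  simpa using this

/-! ### Entries of the correlation matrix -/

section Entries

variable {κ ι : Type*} [DecidableEq κ] {ε : ℝ} {a b : ι → κ}

lemma pairCov_apply_self (h : Function.Injective (Sum.elim a b)) (G : Finset ι) (i : κ) :
    pairCov ε a b G i i = 1 := by
  rw [pairCov, Matrix.add_apply, Matrix.sum_apply, Finset.sum_eq_zero, Matrix.one_apply_eq,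
    add_zero]
  intro g _
  have : ¬ (a g = i ∧ b g = i) := fun e => left_ne_right h g g (e.1.trans e.2.symm)
  have : ¬ (b g = i ∧ a g = i) := fun e => left_ne_right h g g (e.2.trans e.1.symm)
  simp [*]

lemma pairCov_apply_eq_zero {G : Finset ι} {i j : κ} (hij : i ≠ j)
    (h : ∀ g ∈ G, ¬ (a g = i ∧ b g = j) ∧ ¬ (b g = i ∧ a g = j)) :
    pairCov ε a b G i j = 0 := by
  rw [pairCov, Matrix.add_apply, Matrix.sum_apply, Finset.sum_eq_zero, Matrix.one_apply_ne hij,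
    add_zero]
  intro g hg
  simp [(h g hg).1, (h g hg).2]

lemma pairCov_apply_pair (h : Function.Injective (Sum.elim a b)) {G : Finset ι} {g : ι}
    (hg : g ∈ G) : pairCov ε a b G (a g) (b g) = ε := by
  rw [pairCov, Matrix.add_apply, Matrix.sum_apply, Finset.sum_eq_single g,
    Matrix.one_apply_ne (left_ne_right h g g), zero_add]
  · simp [left_ne_right h g g]
  · intro g' _ hne
    simp [left_ne_left h hne, (left_ne_right h _ _).symm]
  · exact fun hg' => absurd hg hg'

lemma pairCov_apply_pair' (h : Function.Injective (Sum.elim a b)) {G : Finset ι} {g : ι}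
    (hg : g ∈ G) : pairCov ε a b G (b g) (a g) = ε := by
  rw [pairCov, Matrix.add_apply, Matrix.sum_apply, Finset.sum_eq_single g,
    Matrix.one_apply_ne (left_ne_right h g g).symm, zero_add]
  · simp [left_ne_right h g g]
  · intro g' _ hne
    simp [left_ne_right h, right_ne_right h hne]
  · exact fun hg' => absurd hg hg'

lemma abs_pairCov_apply_le (h : Function.Injective (Sum.elim a b)) (G : Finset ι) {i j : κ}
    (hij : i ≠ j) : |pairCov ε a b G i j| ≤ |ε| := by
  by_cases hg : ∀ g ∈ G, ¬ (a g = i ∧ b g = j) ∧ ¬ (b g = i ∧ a g = j)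
  · rw [pairCov_apply_eq_zero hij hg, abs_zero]
    exact abs_nonneg ε
  · push Not at hg
    obtain ⟨g, hg, hor⟩ := hg
    by_cases h1 : a g = i ∧ b g = j
    · rw [← h1.1, ← h1.2, pairCov_apply_pair h hg]
    · obtain ⟨rfl, rfl⟩ := hor (by tauto)
      rw [pairCov_apply_pair' h hg]

end Entries

/-! ### Mixing of Gaussian vectors with correlated neighbours -/

section Mixing

open WithLp

variable {p : ℕ}

/-- The `σ`-field generated by the coordinates whose positions have the property `A`. -/
lemma iSup_comap_eq_comap (π : Equiv.Perm (Fin p)) (A : Fin p → Prop) :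
    (⨆ (j : Fin p) (_ : A j),
      MeasurableSpace.comap (fun x : Vec p => x (π j)) inferInstance) =
      MeasurableSpace.comap (fun (x : Vec p) (j : {j // A j}) => x (π j)) MeasurableSpace.pi := by
  rw [MeasurableSpace.pi, MeasurableSpace.comap_iSup, iSup_subtype]
  simp_rw [MeasurableSpace.comap_comp]
  rfl

lemma iSup_comap_le (π : Equiv.Perm (Fin p)) (A : Fin p → Prop) :
    (⨆ (j : Fin p) (_ : A j),
      MeasurableSpace.comap (fun x : Vec p => x (π j)) inferInstance) ≤
      (inferInstance : MeasurableSpace (Vec p)) :=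
  iSup_le fun _ => iSup_le fun _ => Measurable.comap_le (by fun_prop)

lemma indep_of_uncorrelated {μ : Vec p} {S : Matrix (Fin p) (Fin p) ℝ} (hS : S.PosSemidef)
    (π : Equiv.Perm (Fin p)) {A B : Fin p → Prop}
    (h : ∀ j k, A j → B k → S (π j) (π k) = 0) :
    Indep (⨆ (j : Fin p) (_ : A j),
        MeasurableSpace.comap (fun x : Vec p => x (π j)) inferInstance)
      (⨆ (j : Fin p) (_ : B j),
        MeasurableSpace.comap (fun x : Vec p => x (π j)) inferInstance)
      (multivariateGaussian μ S) := by
  classical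
  rw [iSup_comap_eq_comap, iSup_comap_eq_comap]
  let L : Vec p →L[ℝ] ({j // A j} → ℝ) × ({j // B j} → ℝ) :=
    (ContinuousLinearMap.pi fun j : {j // A j} => EuclideanSpace.proj (π j)).prod
      (ContinuousLinearMap.pi fun j : {j // B j} => EuclideanSpace.proj (π j))
  have hG : HasGaussianLaw (fun x : Vec p => ((fun i : {j // A j} => x (π i)),
      fun i : {j // B j} => x (π i))) (multivariateGaussian μ S) := by
    have := (IsGaussian.hasGaussianLaw_id (μ := multivariateGaussian μ S)).map L
    exact this
  exact HasGaussianLaw.indepFun_of_covariance_eval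
    (X := fun (i : {j // A j}) (x : Vec p) => x (π i))
    (Y := fun (i : {j // B j}) (x : Vec p) => x (π i)) hG fun i j => by
      rw [covariance_eval_multivariateGaussian hS, h _ _ i.2 j.2]

lemma mem_update_iff (π : Equiv.Perm (Fin p)) {A : Fin p → Prop} {s : Set (Vec p)}
    (hs : MeasurableSet[⨆ (j : Fin p) (_ : A j),
      MeasurableSpace.comap (fun x : Vec p => x (π j)) inferInstance] s)
    {c : Fin p} (hc : ¬ A (π.symm c)) (μ : Vec p) (x : Fin p → ℝ) (y : ℝ) :
    μ + toLp 2 (Function.update x c y) ∈ s ↔ μ + toLp 2 x ∈ s := by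
  rw [iSup_comap_eq_comap] at hs
  obtain ⟨t, -, rfl⟩ := hs
  simp only [Set.mem_preimage]
  have : (fun j : {j // A j} => (μ + toLp 2 (Function.update x c y) : Vec p) (π j)) =
      fun j : {j // A j} => (μ + toLp 2 x : Vec p) (π j) := by
    ext j
    have : π j ≠ c := by
      rintro rfl
      exact hc (by simpa using j.2)
    simp [this]
  rw [this]

variable {ι : Type*} [DecidableEq ι] {ε : ℝ} {a b : ι → Fin p}

/-- Correlating two coordinates does not change the law of the other ones together with at most
one of the two. -/
lemma multivariateGaussian_pairCov_insert_apply (hε : |ε| < 1)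
    (h : Function.Injective (Sum.elim a b)) {g : ι} {G : Finset ι} (hg : g ∉ G) (μ : Vec p)
    (π : Equiv.Perm (Fin p)) {A : Fin p → Prop}
    (hA : ¬ A (π.symm (a g)) ∨ ¬ A (π.symm (b g))) {s : Set (Vec p)}
    (hs : MeasurableSet[⨆ (j : Fin p) (_ : A j),
      MeasurableSpace.comap (fun x : Vec p => x (π j)) inferInstance] s) :
    multivariateGaussian μ (pairCov ε a b (insert g G)) s =
      multivariateGaussian μ (pairCov ε a b G) s := by
  have hs' : MeasurableSet s := iSup_comap_le π A s hs
  have hm : Measurable (s.indicator (1 : Vec p → ℝ≥0∞)) := measurable_one.indicator hs'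
  have hmu : Measurable fun x : Fin p → ℝ => μ + toLp 2 x := by fun_prop
  set D : (Fin p → ℝ) → ℝ≥0∞ := fun x => s.indicator (1 : Vec p → ℝ≥0∞) (μ + toLp 2 x) *
    ∏ g ∈ G, mehler ε (x (a g)) (x (b g)) with hD
  have hDm : Measurable D :=
    (hm.comp hmu).mul (Finset.measurable_prod _ fun g _ => by fun_prop)
  have hDu : ∀ c, ¬ A (π.symm c) → (∀ g' ∈ G, a g' ≠ c ∧ b g' ≠ c) →
      ∀ x y, D (Function.update x c y) = D x := by
    intro c hc hne x y
    simp only [hD]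
    congr 1
    · have hiff := mem_update_iff π hs hc μ x y
      by_cases hx : μ + toLp 2 x ∈ s
      · rw [Set.indicator_of_mem hx, Set.indicator_of_mem (hiff.2 hx)]
        rfl
      · rw [Set.indicator_of_notMem hx, Set.indicator_of_notMem (mt hiff.1 hx)]
    · refine Finset.prod_congr rfl fun g' hg' => ?_
      rw [Function.update_of_ne (hne g' hg').1, Function.update_of_ne (hne g' hg').2]
  rw [← lintegral_indicator_one hs', ← lintegral_indicator_one hs',
    lintegral_multivariateGaussian_pairCov hε h _ μ hm,
    lintegral_multivariateGaussian_pairCov hε h _ μ hm]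
  have e : ∀ x : Fin p → ℝ, s.indicator (1 : Vec p → ℝ≥0∞) (μ + toLp 2 x) *
      ∏ g ∈ insert g G, mehler ε (x (a g)) (x (b g)) =
      D x * mehler ε (x (a g)) (x (b g)) := by
    intro x
    rw [Finset.prod_insert hg, hD]
    ring
  simp_rw [e]
  -- The end outside `A` is absent from the event and from all other kernels, so the new kernel is
  -- integrated out along it.
  rcases hA with hA | hA
  · exact lintegral_mul_mehler_left hε (left_ne_right h g g) hDm (hDu _ hA fun g' hg' =>
      ⟨left_ne_left h (ne_of_mem_of_not_mem hg' hg), (left_ne_right h _ _).symm⟩)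
  · exact lintegral_mul_mehler_right hε (left_ne_right h g g) hDm (hDu _ hA fun g' hg' =>
      ⟨left_ne_right h _ _, right_ne_right h (ne_of_mem_of_not_mem hg' hg)⟩)

lemma lintegral_mehler_sq_pairCov (hε : |ε| < 1) (h : Function.Injective (Sum.elim a b)) {g : ι}
    {G : Finset ι} (hg : g ∉ G) (μ : Vec p) :
    ∫⁻ x, mehler ε (x (a g) - μ (a g)) (x (b g) - μ (b g)) ^ 2
      ∂(multivariateGaussian μ (pairCov ε a b G)) = ENNReal.ofReal (1 - ε ^ 2)⁻¹ := by
  have h1 : ∫⁻ x, ∏ g ∈ G, mehler ε (x (a g)) (x (b g)) ∂(stdPi (Fin p)) = 1 := by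
    have := lintegral_multivariateGaussian_pairCov hε h G μ (f := fun _ => 1) measurable_const
    simpa using this.symm
  rw [lintegral_multivariateGaussian_pairCov hε h _ μ (by fun_prop)]
  simp only [PiLp.add_apply, add_sub_cancel_left]
  simp_rw [mul_comm (mehler ε _ _ ^ 2)]
  rw [lintegral_mul_mehler_sq hε (left_ne_right h g g)
    (D := fun x => ∏ g ∈ G, mehler ε (x (a g)) (x (b g)))
    (Finset.measurable_prod _ fun g _ => by fun_prop), h1, one_mul]
  · intro x y
    refine Finset.prod_congr rfl fun g' hg' => ?_
    rw [Function.update_of_ne (left_ne_left h (ne_of_mem_of_not_mem hg' hg)),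
      Function.update_of_ne (left_ne_right h _ _).symm]
  · intro x y
    refine Finset.prod_congr rfl fun g' hg' => ?_
    rw [Function.update_of_ne (left_ne_right h _ _),
      Function.update_of_ne (right_ne_right h (ne_of_mem_of_not_mem hg' hg))]

/-- The ends of a pair are neighbours. A gap of lag two or more cannot lie inside a pair, so the
blocks are uncorrelated, hence independent. At lag one at most one pair is cut; without it the
blocks are independent with unchanged laws, so the coefficient is at most `√χ²` of that pair. -/
lemma mixingCoeff_pairCov_le [Fintype ι] (hε : |ε| < 1) (h : Function.Injective (Sum.elim a b))
    (π : Equiv.Perm (Fin p)) (hπ : ∀ g, (π.symm (b g) : ℕ) = π.symm (a g) + 1) (μ : Vec p)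
    {k : ℕ} (hk : 1 ≤ k) :
    mixingCoeff (multivariateGaussian μ (pairCov ε a b Finset.univ)) π k ≤
      if k = 1 then ENNReal.ofReal √((1 - ε ^ 2)⁻¹ - 1) else 0 := by
  refine iSup_le fun m => iSup_le fun hm => ?_
  have hzero : ∀ G : Finset ι, (∀ g ∈ G, ¬ ((π.symm (a g) : ℕ) + 1 ≤ m ∧
      m + k ≤ (π.symm (b g) : ℕ) + 1)) →
      Indep (coordField π 1 m) (coordField π (m + k) p)
        (multivariateGaussian μ (pairCov ε a b G)) := by
    intro G hG
    refine indep_of_uncorrelated (pairCov_posSemidef hε h G) π fun j j' hj hj' => ?_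
    refine pairCov_apply_eq_zero (fun e => ?_) fun g hg => ⟨?_, ?_⟩
    · have := congrArg Fin.val (π.injective e)
      omega
    · rintro ⟨e₁, e₂⟩
      refine hG g hg ?_
      simp only [e₁, e₂, Equiv.symm_apply_apply]
      omega
    · rintro ⟨e₁, e₂⟩
      have := hπ g
      simp only [e₁, e₂, Equiv.symm_apply_apply] at this
      omega
  have hle₁ := iSup_comap_le π fun j : Fin p => 1 ≤ (j : ℕ) + 1 ∧ (j : ℕ) + 1 ≤ m
  have hle₂ := iSup_comap_le π fun j : Fin p => m + k ≤ (j : ℕ) + 1 ∧ (j : ℕ) + 1 ≤ p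
  by_cases hcross : ∃ g, (π.symm (a g) : ℕ) + 1 ≤ m ∧ m + k ≤ (π.symm (b g) : ℕ) + 1
  · obtain ⟨g, hg₁, hg₂⟩ := hcross
    have hg := hπ g
    have hk1 : k = 1 := by omega
    rw [if_pos hk1]
    have hnot : g ∉ Finset.univ.erase g := by simp
    have huniv : insert g (Finset.univ.erase g) = Finset.univ :=
      Finset.insert_erase (Finset.mem_univ g)
    have hχ : 0 ≤ (1 - ε ^ 2)⁻¹ - 1 := by
      have := one_le_inv₀ (one_sub_sq_pos hε)
      have := this.2 (by nlinarith [sq_nonneg ε])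
      linarith
    have hins := multivariateGaussian_pairCov_insert hε h hnot μ
    have heq := fun (A : Fin p → Prop) hA s hs =>
      multivariateGaussian_pairCov_insert_apply hε h hnot μ π (A := A) hA (s := s) hs
    have hsq := lintegral_mehler_sq_pairCov hε h hnot μ
    rw [huniv] at hins heq
    have hd : Measurable fun x : Vec p =>
        mehler ε (x (a g) - μ (a g)) (x (b g) - μ (b g)) := by fun_prop
    refine (betaCoeff_withDensity_le hins hle₁ hle₂ (heq _ (Or.inr (by omega)))
      (heq _ (Or.inl (by omega))) (hzero _ fun g' hg' hc => ?_)).trans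
      (lintegral_sub_one_le hd ?_ hχ (by rw [hsq]; simp))
    -- A second pair across the same cut would have its left end at the same position.
    · refine Finset.ne_of_mem_erase hg' ?_
      have := hπ g'
      have e : π.symm (a g') = π.symm (a g) := Fin.ext (by omega)
      by_contra hne
      exact left_ne_left h hne (π.symm.injective e)
    · rw [← setLIntegral_univ, ← withDensity_apply _ MeasurableSet.univ, ← hins, measure_univ]
  · push Not at hcross
    rw [betaCoeff_eq_zero_of_indep hle₁ hle₂ (hzero _ fun g _ hc => by
      have := hcross g hc.1
      omega)]
    exact zero_le

end Mixing

/-! ### Regular pairs -/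

section Regular

variable {p : ℕ} {ι : Type*} [DecidableEq ι] [Fintype ι] {a b : ι → Fin p}

/-- The perturbations that keep the conditions on the populations. -/
structure Params.IsSmall (K : Params) (ε : ℝ) : Prop where
  lt_one : |ε| < 1
  corr : 2 * |ε| < 1 - K.ρ₀
  mixing : √((1 - ε ^ 2)⁻¹ - 1) ≤ K.C * K.γ

/-- Two values of `ε` over the same pairs share one permutation. One or both will be `0`, which
gives the identity matrix. -/
lemma regular_pairCov {K : Params} (hK : K.Admissible) {ε₁ ε₂ : ℝ} (h₁ : K.IsSmall ε₁)
    (h₂ : K.IsSmall ε₂) (h : Function.Injective (Sum.elim a b)) (π : Equiv.Perm (Fin p))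
    (hπ : ∀ g, (π.symm (b g) : ℕ) = π.symm (a g) + 1) (μ₁ μ₂ : Vec p) :
    Regular K μ₁ μ₂ (pairCov ε₁ a b Finset.univ) (pairCov ε₂ a b Finset.univ) := by
  have hmix : ∀ ε μ k, K.IsSmall ε → 1 ≤ k →
      mixingCoeff (multivariateGaussian μ (pairCov ε a b Finset.univ)) π k ≤
        ENNReal.ofReal (K.C * K.γ ^ k) := by
    intro ε μ k hε hk
    refine (mixingCoeff_pairCov_le hε.lt_one h π hπ μ hk).trans ?_
    split_ifs with h1
    · subst h1
      rw [pow_one]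
      exact ENNReal.ofReal_le_ofReal hε.mixing
    · exact zero_le
  have hvar : ∀ ε μ, K.IsSmall ε → BoundedVariances K.τ μ (pairCov ε a b Finset.univ) :=
    fun ε μ hε => boundedVariances_of_diag hK.τ_mem (pairCov_posSemidef hε.lt_one h _)
      (pairCov_apply_self h _)
  have hcor : ∀ ε μ, K.IsSmall ε → BoundedCorrelations K.ρ₀ μ (pairCov ε a b Finset.univ) :=
    fun ε μ hε => boundedCorrelations_of_weak (pairCov_posSemidef hε.lt_one h _)
      (pairCov_apply_self h _) hε.lt_one.le hε.corr fun _ _ => abs_pairCov_apply_le h _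
  exact ⟨pairCov_posSemidef h₁.lt_one h _, pairCov_posSemidef h₂.lt_one h _, hvar _ _ h₁,
    hvar _ _ h₂, hcor _ _ h₁, hcor _ _ h₂,
    π, fun k hk _ => ⟨hmix _ _ _ h₁ hk, hmix _ _ _ h₂ hk⟩⟩

lemma pairCov_zero {κ ι : Type*} [DecidableEq κ] (a b : ι → κ) (G : Finset ι) : pairCov 0 a b G = 1 := by
  simp [pairCov]

lemma Params.isSmall_zero {K : Params} (hK : K.Admissible) : K.IsSmall 0 where
  lt_one := by simp
  corr := by simpa using hK.ρ₀_mem.2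
  mixing := by simpa using (mul_pos hK.C_pos hK.γ_mem.1).le

end Regular

/-! ### The second moment method -/

/-- If the average of the densities of finitely many alternatives has second moment at most
`1 + χ`, a test cannot separate all of them from the hypothesis. -/
lemma exists_lintegral_withDensity_le {Ω J : Type*} {_ : MeasurableSpace Ω} {Q : Measure Ω}
    [IsProbabilityMeasure Q] [Fintype J] [Nonempty J] {L : J → Ω → ℝ≥0∞}
    (hL : ∀ e, Measurable (L e)) (h1 : ∀ e, ∫⁻ x, L e x ∂Q = 1) {χ : ℝ} (hχ : 0 ≤ χ)
    (h2 : ∑ e, ∑ f, ∫⁻ x, L e x * L f x ∂Q ≤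
      ENNReal.ofReal (1 + χ) * (Fintype.card J : ℝ≥0∞) ^ 2)
    {W : Ω → ℝ≥0∞} (hW : Measurable W) (hW1 : ∀ x, W x ≤ 1) :
    ∃ e, ∫⁻ x, W x ∂(Q.withDensity (L e)) ≤ ∫⁻ x, W x ∂Q + ENNReal.ofReal √χ := by
  set N : ℝ≥0∞ := (Fintype.card J : ℝ≥0∞) with hN
  have hN0 : N ≠ 0 := by simp [hN]
  have hNt : N ≠ ⊤ := by simp [hN]
  set d : Ω → ℝ≥0∞ := fun x => N⁻¹ * ∑ e, L e x with hd
  have hsm : Measurable fun x => ∑ e, L e x := Finset.measurable_sum _ fun e _ => hL e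
  have hdm : Measurable d := hsm.const_mul _
  have hd1 : ∫⁻ x, d x ∂Q = 1 := by
    rw [hd, lintegral_const_mul _ hsm, lintegral_finsetSum _ fun e _ => hL e]
    simp only [h1, Finset.sum_const, Finset.card_univ, nsmul_eq_mul, mul_one]
    exact ENNReal.inv_mul_cancel hN0 hNt
  have hd2 : ∫⁻ x, d x ^ 2 ∂Q ≤ ENNReal.ofReal (1 + χ) := by
    have e1 : ∀ x, d x ^ 2 = (N⁻¹) ^ 2 * ∑ e, ∑ f, L e x * L f x := by
      intro x
      rw [hd, mul_pow, sq (∑ e, L e x), Finset.sum_mul_sum]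
    have hm2 : ∀ e f, Measurable fun x => L e x * L f x := fun e f => (hL e).mul (hL f)
    simp_rw [e1]
    rw [lintegral_const_mul _ (Finset.measurable_sum _ fun e _ =>
      Finset.measurable_sum _ fun f _ => hm2 e f), lintegral_finsetSum _ fun e _ =>
      Finset.measurable_sum _ fun f _ => hm2 e f]
    simp_rw [lintegral_finsetSum _ fun f _ => hm2 _ f]
    calc _ ≤ (N⁻¹) ^ 2 * (ENNReal.ofReal (1 + χ) * N ^ 2) := by gcongr
      _ = ENNReal.ofReal (1 + χ) * (N⁻¹ * N) ^ 2 := by ring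
      _ = _ := by rw [ENNReal.inv_mul_cancel hN0 hNt, one_pow, mul_one]
  have hWd : ∫⁻ x, W x * d x ∂Q ≤ ∫⁻ x, W x ∂Q + ENNReal.ofReal √χ := by
    refine le_trans ?_ (add_le_add_right (lintegral_sub_one_le hdm hd1 hχ hd2) _)
    rw [← lintegral_add_left hW]
    refine lintegral_mono fun x => ?_
    calc W x * d x ≤ W x * (1 + (d x - 1)) := by gcongr; exact le_add_tsub
      _ = W x + W x * (d x - 1) := by ring
      _ ≤ W x + 1 * (d x - 1) := by gcongr; exact hW1 x
      _ = _ := by rw [one_mul]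
  have hsum : ∑ e, ∫⁻ x, W x ∂(Q.withDensity (L e)) ≤
      ∑ _e : J, (∫⁻ x, W x ∂Q + ENNReal.ofReal √χ) := by
    have e2 : ∀ e, ∫⁻ x, W x ∂(Q.withDensity (L e)) = ∫⁻ x, W x * L e x ∂Q := by
      intro e
      rw [lintegral_withDensity_eq_lintegral_mul _ (hL e) hW]
      simp [mul_comm]
    simp_rw [e2]
    have hWL : ∀ e, Measurable fun x => W x * L e x := fun e => hW.mul (hL e)
    rw [← lintegral_finsetSum _ fun e _ => hWL e, Finset.sum_const, Finset.card_univ,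
      nsmul_eq_mul]
    refine le_trans (le_of_eq ?_) (mul_le_mul_right hWd N)
    have hWdm : Measurable fun x => W x * d x := hW.mul hdm
    rw [← lintegral_const_mul _ hWdm]
    congr 1
    ext x
    rw [← Finset.mul_sum, hd]
    calc W x * ∑ e, L e x = (N * N⁻¹) * (W x * ∑ e, L e x) := by
          rw [ENNReal.mul_inv_cancel hN0 hNt, one_mul]
      _ = _ := by ring
  -- Otherwise every term, and hence the sum, would exceed the bound on the average.
  by_contra! hlt
  exact (ENNReal.sum_lt_sum_of_nonempty Finset.univ_nonempty fun e _ => hlt e).not_ge hsum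

/-- The second moment bound for alternatives that are composed of independent choices in
several groups. -/
lemma sum_sum_prod_ite_le {ι σ : Type*} [Fintype ι] [DecidableEq ι] [Fintype σ] [DecidableEq σ]
    [Nonempty σ] {c : ℝ} (hc : 0 ≤ c) (n : ℕ) :
    ∑ e : ι → σ, ∑ f : ι → σ,
        (∏ g, if e g = f g then ENNReal.ofReal c else 1) ^ n ≤
      ENNReal.ofReal (1 + (Real.exp (Fintype.card ι * (c ^ n / Fintype.card σ)) - 1)) *
        (Fintype.card (ι → σ) : ℝ≥0∞) ^ 2 := by
  set N : ℝ := ((Fintype.card σ : ℕ) : ℝ) with hN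
  have hN0 : 0 < N := by
    rw [hN]
    exact_mod_cast Fintype.card_pos
  have h1 : ∀ e : ι → σ, ∑ f : ι → σ, (∏ g, if e g = f g then ENNReal.ofReal c else 1) ^ n ≤
      ENNReal.ofReal ((c ^ n + N) ^ Fintype.card ι) := by
    intro e
    -- In one group a single choice agrees with `v`, and all others give `1`. Counting `1` for the
    -- agreeing choice too costs nothing essential.
    have h2 : ∀ v, ∑ w : σ, (if v = w then ENNReal.ofReal c else 1) ^ n ≤
        ENNReal.ofReal (c ^ n + N) := by
      intro v
      calc _ ≤ ∑ w : σ, ((if v = w then ENNReal.ofReal c ^ n else 0) + 1) := by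
            refine Finset.sum_le_sum fun w _ => ?_
            split_ifs <;> simp
        _ = _ := by
            rw [Finset.sum_add_distrib, Finset.sum_ite_eq, ENNReal.ofReal_add (by positivity) hN0.le,
              ENNReal.ofReal_pow hc]
            simp [hN]
    simp_rw [← Finset.prod_pow]
    -- Choices in different groups are free of each other, so the sum over `f` is a product over
    -- groups.
    rw [← Fintype.prod_sum fun g w => (if e g = w then ENNReal.ofReal c else 1) ^ n]
    refine (Finset.prod_le_prod' fun g _ => h2 (e g)).trans ?_
    rw [Finset.prod_const, Finset.card_univ, ENNReal.ofReal_pow (by positivity)]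
  refine (Finset.sum_le_sum fun e _ => h1 e).trans ?_
  rw [Finset.sum_const, Finset.card_univ, nsmul_eq_mul, sq, ← mul_assoc, mul_comm]
  gcongr
  have h3 : (Fintype.card (ι → σ) : ℝ≥0∞) = ENNReal.ofReal (N ^ Fintype.card ι) := by
    rw [Fintype.card_fun, ENNReal.ofReal_pow hN0.le, hN]
    simp
  rw [add_sub_cancel, h3, ← ENNReal.ofReal_mul (by positivity)]
  refine ENNReal.ofReal_le_ofReal ?_
  have h4 : c ^ n + N = (1 + c ^ n / N) * N := by
    field_simp
    ring
  rw [h4, mul_pow]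
  gcongr
  rw [Real.exp_nat_mul]
  gcongr
  rw [add_comm]
  exact Real.add_one_le_exp _

/-! ### Densities of samples -/

lemma lintegral_pi_prod {E : Type*} [MeasurableSpace E] {n : ℕ} (ν : Measure E)
    [IsProbabilityMeasure ν] {f : Fin n → E → ℝ≥0∞} (hf : ∀ i, Measurable (f i)) :
    ∫⁻ x, ∏ i, f i (x i) ∂(Measure.pi fun _ : Fin n => ν) = ∏ i, ∫⁻ x, f i x ∂ν := by
  rw [lintegral_prod_eq_prod_lintegral_of_indepFun Finset.univ (fun i (x : Fin n → E) => f i (x i))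
    (iIndepFun_pi fun i => (hf i).aemeasurable) fun i => (hf i).comp (measurable_pi_apply i)]
  refine Finset.prod_congr rfl fun i _ => ?_
  exact (measurePreserving_eval (fun _ : Fin n => ν) i).lintegral_comp (hf i)

lemma pi_withDensity {E : Type*} [MeasurableSpace E] {n : ℕ} (ν : Measure E)
    [IsProbabilityMeasure ν] {f : E → ℝ≥0∞} (hf : Measurable f)
    [IsProbabilityMeasure (ν.withDensity f)] :
    (Measure.pi fun _ : Fin n => ν.withDensity f) =
      (Measure.pi fun _ : Fin n => ν).withDensity fun x => ∏ i, f (x i) := by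
  refine Measure.pi_eq fun s hs => ?_
  rw [withDensity_apply _ (MeasurableSet.univ_pi hs),
    ← lintegral_indicator (MeasurableSet.univ_pi hs)]
  have h1 : ∀ x : Fin n → E, (Set.univ.pi s).indicator (fun x => ∏ i, f (x i)) x =
      ∏ i, (s i).indicator f (x i) := by
    intro x
    by_cases hx : x ∈ Set.univ.pi s
    · rw [Set.indicator_of_mem hx]
      exact Finset.prod_congr rfl fun i _ => (Set.indicator_of_mem (hx i (Set.mem_univ i)) f).symm
    · rw [Set.indicator_of_notMem hx]
      simp only [Set.mem_univ_pi, not_forall] at hx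
      obtain ⟨i, hi⟩ := hx
      exact (Finset.prod_eq_zero (Finset.mem_univ i) (Set.indicator_of_notMem hi f)).symm
  simp_rw [h1]
  rw [lintegral_pi_prod ν fun i => hf.indicator (hs i)]
  refine Finset.prod_congr rfl fun i _ => ?_
  rw [lintegral_indicator (hs i), withDensity_apply _ (hs i)]

instance {p n₁ n₂ : ℕ} (μ₁ μ₂ : Vec p) (S₁ S₂ : Matrix (Fin p) (Fin p) ℝ) :
    IsProbabilityMeasure (sampleLaw n₁ n₂ μ₁ μ₂ S₁ S₂) := by
  unfold sampleLaw
  infer_instance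

/-! ### The prior: one correlated pair chosen in each group. -/

section Prior

variable {p : ℕ} {ι σ : Type*} {ε : ℝ} {left right : ι × σ → Fin p}

lemma injective_choice (h : Function.Injective (Sum.elim left right)) (e : ι → σ × σ) :
    Function.Injective (Sum.elim (fun g => left (g, (e g).1)) fun g => right (g, (e g).2)) := by
  rintro (g | g) (g' | g') hg
  · have := @h (Sum.inl _) (Sum.inl _) hg
    simp at this
    rw [this.1]
  · exact absurd (@h (Sum.inl _) (Sum.inr _) hg) (by simp)
  · exact absurd (@h (Sum.inr _) (Sum.inl _) hg) (by simp)
  · have := @h (Sum.inr _) (Sum.inr _) hg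
    simp at this
    rw [this.1]

variable [Fintype ι]

/-- The correlation matrix with one correlated pair in each group, chosen by `e`. -/
noncomputable abbrev choiceCov (ε : ℝ) (left right : ι × σ → Fin p) (e : ι → σ × σ) :
    Matrix (Fin p) (Fin p) ℝ :=
  pairCov ε (fun g => left (g, (e g).1)) (fun g => right (g, (e g).2)) Finset.univ

/-- The density of one observation. -/
noncomputable def choiceDensity (ε : ℝ) (left right : ι × σ → Fin p) (e : ι → σ × σ) (μ : Vec p)
    (x : Vec p) : ℝ≥0∞ :=
  ∏ g, mehler ε (x (left (g, (e g).1)) - μ (left (g, (e g).1)))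
    (x (right (g, (e g).2)) - μ (right (g, (e g).2)))

lemma measurable_choiceDensity (e : ι → σ × σ) (μ : Vec p) :
    Measurable (choiceDensity ε left right e μ) :=
  Finset.measurable_prod _ fun g _ => by fun_prop

variable [DecidableEq ι]

lemma multivariateGaussian_choiceCov (hε : |ε| < 1)
    (h : Function.Injective (Sum.elim left right)) (e : ι → σ × σ) (μ : Vec p) :
    multivariateGaussian μ (choiceCov ε left right e) =
      (multivariateGaussian μ 1).withDensity (choiceDensity ε left right e μ) :=
  multivariateGaussian_pairCov_eq_withDensity hε (injective_choice h e) _ μ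

variable [DecidableEq σ]

/-- Agreement at one end only leaves no trace. A group therefore counts only if both ends agree,
which happens for one of `s²` choices instead of one of `s`. -/
lemma lintegral_choiceDensity_mul (hε : |ε| < 1) (h : Function.Injective (Sum.elim left right))
    (e f : ι → σ × σ) (μ : Vec p) :
    ∫⁻ x, choiceDensity ε left right e μ x * choiceDensity ε left right f μ x
      ∂(multivariateGaussian μ 1) =
      ∏ g, if e g = f g then ENNReal.ofReal (1 - ε ^ 2)⁻¹ else 1 := by
  rw [lintegral_multivariateGaussian_one μ
    (f := fun x => choiceDensity ε left right e μ x * choiceDensity ε left right f μ x)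
    ((measurable_choiceDensity e μ).mul (measurable_choiceDensity f μ))]
  simp only [choiceDensity, PiLp.add_apply, add_sub_cancel_left, ← Finset.prod_mul_distrib]
  have hl : ∀ g u g' u', left (g, u) = left (g', u') ↔ g = g' ∧ u = u' := by
    intro g u g' u'
    constructor
    · intro hg
      simpa using @h (Sum.inl _) (Sum.inl _) hg
    · rintro ⟨rfl, rfl⟩
      rfl
  have hr : ∀ g u g' u', right (g, u) = right (g', u') ↔ g = g' ∧ u = u' := by
    intro g u g' u'
    constructor
    · intro hg
      simpa using @h (Sum.inr _) (Sum.inr _) hg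
    · rintro ⟨rfl, rfl⟩
      rfl
  have hlr : ∀ g u g' u', left (g, u) ≠ right (g', u') := fun g u g' u' =>
    left_ne_right h _ _
  rw [lintegral_prod_mehler_mul_mehler (a := fun g => left (g, (e g).1))
    (b := fun g => right (g, (e g).2)) (a' := fun g => left (g, (f g).1))
    (b' := fun g => right (g, (f g).2)) hε Finset.univ (fun _ _ => hlr _ _ _ _)
    (fun _ _ => hlr _ _ _ _) (fun _ _ => hlr _ _ _ _) (fun _ _ => hlr _ _ _ _)
    (fun _ _ hg hg' => hg ((hl _ _ _ _).1 hg').1) (fun _ _ hg hg' => hg ((hl _ _ _ _).1 hg').1)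
    (fun _ _ hg hg' => hg ((hr _ _ _ _).1 hg').1) (fun _ _ hg hg' => hg ((hr _ _ _ _).1 hg').1)
    (fun _ _ hg hg' => hg ((hr _ _ _ _).1 hg').1)]
  refine Finset.prod_congr rfl fun g _ => ?_
  simp only [hl, hr, true_and, Prod.ext_iff]

lemma lintegral_sample_choiceDensity_mul (hε : |ε| < 1)
    (h : Function.Injective (Sum.elim left right)) (e f : ι → σ × σ) (μ : Vec p) (n : ℕ) :
    ∫⁻ x, (∏ i, choiceDensity ε left right e μ (x i)) *
        ∏ i, choiceDensity ε left right f μ (x i)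
      ∂(Measure.pi fun _ : Fin n => multivariateGaussian μ (1 : Matrix (Fin p) (Fin p) ℝ)) =
      (∏ g, if e g = f g then ENNReal.ofReal (1 - ε ^ 2)⁻¹ else 1) ^ n := by
  simp_rw [← Finset.prod_mul_distrib]
  rw [lintegral_pi_prod (multivariateGaussian μ 1)
    (f := fun _ x => choiceDensity ε left right e μ x * choiceDensity ε left right f μ x)
    fun _ => (measurable_choiceDensity e μ).mul (measurable_choiceDensity f μ)]
  simp [lintegral_choiceDensity_mul hε h]

variable [Fintype σ] [Nonempty σ]

lemma exists_choice_of_density (hε : |ε| < 1) {n : ℕ} {Ω : Type*} {_ : MeasurableSpace Ω}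
    {Q : Measure Ω} [IsProbabilityMeasure Q] {L : (ι → σ × σ) → Ω → ℝ≥0∞}
    (hL : ∀ e, Measurable (L e)) (h1 : ∀ e, IsProbabilityMeasure (Q.withDensity (L e)))
    (h2 : ∀ e f, ∫⁻ x, L e x * L f x ∂Q =
      (∏ g, if e g = f g then ENNReal.ofReal (1 - ε ^ 2)⁻¹ else 1) ^ n)
    {W : Ω → ℝ≥0∞} (hW : Measurable W) (hW1 : ∀ x, W x ≤ 1) :
    ∃ e, ∫⁻ x, W x ∂(Q.withDensity (L e)) ≤ ∫⁻ x, W x ∂Q + ENNReal.ofReal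
      √(Real.exp (Fintype.card ι * ((1 - ε ^ 2)⁻¹ ^ n / Fintype.card (σ × σ))) - 1) := by
  have hc := inv_nonneg.2 (one_sub_sq_pos hε).le
  refine exists_lintegral_withDensity_le hL (fun e => ?_) ?_ ?_ hW hW1
  · have := (h1 e).measure_univ
    rwa [withDensity_apply _ MeasurableSet.univ, setLIntegral_univ] at this
  · rw [sub_nonneg]
    exact Real.one_le_exp (by positivity)
  · simp_rw [h2]
    exact sum_sum_prod_ite_le hc n

/-- The unperturbed sample is a common independent factor of all the laws, so only `n₁` enters the
bound. -/
lemma exists_rejectProb_left_le (hε : |ε| < 1) (h : Function.Injective (Sum.elim left right))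
    {n₁ n₂ : ℕ} (μ₁ μ₂ : Vec p) {W : Data p n₁ n₂ → ℝ≥0∞} (hW : Measurable W)
    (hW1 : ∀ x, W x ≤ 1) :
    ∃ e : ι → σ × σ, rejectProb μ₁ μ₂ (choiceCov ε left right e) 1 W ≤
      rejectProb μ₁ μ₂ 1 1 W + ENNReal.ofReal
      √(Real.exp (Fintype.card ι * ((1 - ε ^ 2)⁻¹ ^ n₁ / Fintype.card (σ × σ))) - 1) := by
  set L : (ι → σ × σ) → Data p n₁ n₂ → ℝ≥0∞ :=
    fun e d => ∏ i, choiceDensity ε left right e μ₁ (d.1 i) with hL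
  have hm : ∀ e, Measurable fun x : Fin n₁ → Vec p =>
      ∏ i, choiceDensity ε left right e μ₁ (x i) := fun e =>
    Finset.measurable_prod _ fun i _ => (measurable_choiceDensity e μ₁).comp (measurable_pi_apply i)
  have hlaw : ∀ e, sampleLaw n₁ n₂ μ₁ μ₂ (choiceCov ε left right e) 1 =
      (sampleLaw n₁ n₂ μ₁ μ₂ 1 1).withDensity (L e) := by
    intro e
    have hG := multivariateGaussian_choiceCov hε h e μ₁
    have : IsProbabilityMeasure ((multivariateGaussian μ₁ 1).withDensity
        (choiceDensity ε left right e μ₁)) := hG ▸ inferInstance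
    rw [sampleLaw, sampleLaw, hG, pi_withDensity _ (measurable_choiceDensity e μ₁),
      prod_withDensity_left (hm e)]
  obtain ⟨e, he⟩ := exists_choice_of_density hε (n := n₁) (Q := sampleLaw n₁ n₂ μ₁ μ₂ 1 1) (L := L)
    (fun e => (hm e).comp measurable_fst) (fun e => hlaw e ▸ inferInstance) (fun e f => by
      rw [← lintegral_sample_choiceDensity_mul hε h e f μ₁ n₁]
      exact measurePreserving_fst.lintegral_comp ((hm e).mul (hm f))) hW hW1
  exact ⟨e, by simpa only [rejectProb, hlaw] using he⟩

lemma exists_rejectProb_right_le (hε : |ε| < 1) (h : Function.Injective (Sum.elim left right))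
    {n₁ n₂ : ℕ} (μ₁ μ₂ : Vec p) {W : Data p n₁ n₂ → ℝ≥0∞} (hW : Measurable W)
    (hW1 : ∀ x, W x ≤ 1) :
    ∃ e : ι → σ × σ, rejectProb μ₁ μ₂ 1 (choiceCov ε left right e) W ≤
      rejectProb μ₁ μ₂ 1 1 W + ENNReal.ofReal
      √(Real.exp (Fintype.card ι * ((1 - ε ^ 2)⁻¹ ^ n₂ / Fintype.card (σ × σ))) - 1) := by
  set L : (ι → σ × σ) → Data p n₁ n₂ → ℝ≥0∞ :=
    fun e d => ∏ i, choiceDensity ε left right e μ₂ (d.2 i) with hL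
  have hm : ∀ e, Measurable fun x : Fin n₂ → Vec p =>
      ∏ i, choiceDensity ε left right e μ₂ (x i) := fun e =>
    Finset.measurable_prod _ fun i _ => (measurable_choiceDensity e μ₂).comp (measurable_pi_apply i)
  have hlaw : ∀ e, sampleLaw n₁ n₂ μ₁ μ₂ 1 (choiceCov ε left right e) =
      (sampleLaw n₁ n₂ μ₁ μ₂ 1 1).withDensity (L e) := by
    intro e
    have hG := multivariateGaussian_choiceCov hε h e μ₂
    have : IsProbabilityMeasure ((multivariateGaussian μ₂ 1).withDensity
        (choiceDensity ε left right e μ₂)) := hG ▸ inferInstance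
    rw [sampleLaw, sampleLaw, hG, pi_withDensity _ (measurable_choiceDensity e μ₂),
      prod_withDensity_right (hm e)]
  obtain ⟨e, he⟩ := exists_choice_of_density hε (n := n₂) (Q := sampleLaw n₁ n₂ μ₁ μ₂ 1 1) (L := L)
    (fun e => (hm e).comp measurable_snd) (fun e => hlaw e ▸ inferInstance) (fun e f => by
      rw [← lintegral_sample_choiceDensity_mul hε h e f μ₂ n₂]
      exact measurePreserving_snd.lintegral_comp ((hm e).mul (hm f))) hW hW1
  exact ⟨e, by simpa only [rejectProb, hlaw] using he⟩

end Prior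

/-! ### Sparse alternatives -/

/-- Pair `g` goes to the zero-based positions `2g` and `2g + 1`; the remaining coordinates are
placed arbitrarily. -/
lemma exists_perm_adjacent {p m : ℕ} {a b : Fin m → Fin p}
    (h : Function.Injective (Sum.elim a b)) :
    ∃ π : Equiv.Perm (Fin p), ∀ g, (π.symm (b g) : ℕ) = π.symm (a g) + 1 := by
  have hmp : m + m ≤ p := by
    simpa using Fintype.card_le_of_injective _ h
  let pos : Fin m ⊕ Fin m → Fin p := Sum.elim (fun g => ⟨2 * g, by omega⟩)
    fun g => ⟨2 * g + 1, by omega⟩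
  have hpos : Function.Injective pos := by
    rintro (g | g) (g' | g') hg <;> simp only [pos, Sum.elim_inl, Sum.elim_inr, Fin.mk.injEq] at hg
    · exact congrArg _ (Fin.ext (by omega))
    · omega
    · omega
    · exact congrArg _ (Fin.ext (by omega))
  let e := (Equiv.ofInjective pos hpos).symm.trans (Equiv.ofInjective _ h)
  have he : ∀ x, e.extendSubtype (pos x) = Sum.elim a b x := by
    intro x
    rw [Equiv.extendSubtype_apply_of_mem e (pos x) ⟨x, rfl⟩]
    simp only [e, Equiv.trans_apply]
    rw [Equiv.ofInjective_symm_apply hpos x]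
    rfl
  refine ⟨e.extendSubtype, fun g => ?_⟩
  have h1 : e.extendSubtype.symm (a g) = pos (Sum.inl g) := by
    rw [Equiv.symm_apply_eq, he]
    rfl
  have h2 : e.extendSubtype.symm (b g) = pos (Sum.inr g) := by
    rw [Equiv.symm_apply_eq, he]
    rfl
  rw [h1, h2]
  rfl

/-- All left candidates precede all right ones, so each chosen pair is an entry above the diagonal
and is counted once in `support`. -/
lemma exists_injective_halves {p m s : ℕ} (h : 2 * (m * s) ≤ p) :
    ∃ left right : Fin m × Fin s → Fin p,
      Function.Injective (Sum.elim left right) ∧ ∀ x y, left x < right y := by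
  have hlt : ∀ x : Fin m × Fin s, (finProdFinEquiv x : ℕ) < m * s := fun x =>
    (finProdFinEquiv x).2
  refine ⟨fun x => ⟨finProdFinEquiv x, by have := hlt x; omega⟩,
    fun x => ⟨m * s + finProdFinEquiv x, by have := hlt x; omega⟩, ?_, fun x y => ?_⟩
  · rintro (x | x) (y | y) hxy <;>
      simp only [Sum.elim_inl, Sum.elim_inr, Fin.mk.injEq] at hxy
    · exact congrArg _ (finProdFinEquiv.injective (Fin.ext hxy))
    · have := hlt x
      omega
    · have := hlt y
      omega
    · exact congrArg _ (finProdFinEquiv.injective (Fin.ext (by omega)))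
  · have := hlt x
    rw [Fin.lt_def]
    simp only
    omega

/-! ### The chosen pairs give members of the sparse class. -/

section Support

variable {p m : ℕ} {ε : ℝ} {a b : Fin m → Fin p}

lemma pairCov_apply_ne_one_iff (h : Function.Injective (Sum.elim a b)) (hab : ∀ g, a g < b g)
    (hε : ε ≠ 0) (e : Fin p × Fin p) :
    (e.1 ≤ e.2 ∧ pairCov ε a b Finset.univ e.1 e.2 ≠ (1 : Matrix (Fin p) (Fin p) ℝ) e.1 e.2) ↔
      e ∈ Set.range fun g => (a g, b g) := by
  constructor
  · rintro ⟨hle, hne⟩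
    by_cases hd : e.1 = e.2
    · rw [hd, pairCov_apply_self h, Matrix.one_apply_eq] at hne
      exact absurd rfl hne
    · rw [Matrix.one_apply_ne hd] at hne
      by_contra hcon
      refine hne (pairCov_apply_eq_zero hd fun g _ => ⟨?_, ?_⟩)
      · rintro ⟨h1, h2⟩
        exact hcon ⟨g, Prod.ext h1 h2⟩
      · rintro ⟨h1, h2⟩
        have := hab g
        rw [h1, h2] at this
        exact absurd hle (not_le.2 this)
  · rintro ⟨g, rfl⟩
    refine ⟨(hab g).le, ?_⟩
    rw [pairCov_apply_pair h (Finset.mem_univ g), Matrix.one_apply_ne (hab g).ne]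
    exact hε

lemma ncard_range_pair (h : Function.Injective (Sum.elim a b)) :
    (Set.range fun g => (a g, b g)).ncard = m := by
  rw [← Set.image_univ, Set.ncard_image_of_injective, Set.ncard_univ, Nat.card_fin]
  intro g g' hg
  simpa using @h (Sum.inl g) (Sum.inl g') (Prod.ext_iff.1 hg).1

lemma mem_sparseClass_left {K : Params} (hK : K.Admissible) {n₁ n₂ : ℕ} {β c : ℝ}
    (h : Function.Injective (Sum.elim a b)) (hab : ∀ g, a g < b g) (hε : 0 < ε)
    (hsmall : K.IsSmall ε) (hm : m = ⌊numEntries p ^ (1 - β)⌋₊)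
    (hεc : ε = √(2 * c * Real.log (numEntries p) / effSize n₁ n₂)) (μ₁ μ₂ : Vec p) :
    (pairCov ε a b Finset.univ, 1) ∈ sparseClass n₁ n₂ K β c μ₁ μ₂ := by
  obtain ⟨π, hπ⟩ := exists_perm_adjacent h
  have hreg := regular_pairCov hK hsmall (Params.isSmall_zero hK) h π hπ μ₁ μ₂
  rw [pairCov_zero] at hreg
  have hsupp : support (pairCov ε a b Finset.univ) 1 = Set.range fun g => (a g, b g) := by
    ext e
    rw [← pairCov_apply_ne_one_iff h hab hε.ne', support, Set.mem_ofPred_eq, sub_ne_zero]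
  refine ⟨hreg, ?_, ?_⟩
  · rw [hsupp, ncard_range_pair h, hm]
  · rw [hsupp]
    rintro _ ⟨g, rfl⟩
    refine ⟨c, le_rfl, ?_⟩
    simp only
    rw [pairCov_apply_pair h (Finset.mem_univ g), Matrix.one_apply_ne (hab g).ne, sub_zero, hεc]

/-- The differences must be positive, so a perturbation of the second matrix carries the sign `-ε`.
-/
lemma mem_sparseClass_right {K : Params} (hK : K.Admissible) {n₁ n₂ : ℕ} {β c : ℝ}
    (h : Function.Injective (Sum.elim a b)) (hab : ∀ g, a g < b g) (hε : 0 < ε)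
    (hsmall : K.IsSmall (-ε)) (hm : m = ⌊numEntries p ^ (1 - β)⌋₊)
    (hεc : ε = √(2 * c * Real.log (numEntries p) / effSize n₁ n₂)) (μ₁ μ₂ : Vec p) :
    (1, pairCov (-ε) a b Finset.univ) ∈ sparseClass n₁ n₂ K β c μ₁ μ₂ := by
  obtain ⟨π, hπ⟩ := exists_perm_adjacent h
  have hreg := regular_pairCov hK (Params.isSmall_zero hK) hsmall h π hπ μ₁ μ₂
  rw [pairCov_zero] at hreg
  have hsupp : support 1 (pairCov (-ε) a b Finset.univ) = Set.range fun g => (a g, b g) := by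
    ext e
    rw [← pairCov_apply_ne_one_iff h hab (neg_ne_zero.2 hε.ne'), support, Set.mem_ofPred_eq,
      sub_ne_zero, ne_comm]
  refine ⟨hreg, ?_, ?_⟩
  · rw [hsupp, ncard_range_pair h, hm]
  · rw [hsupp]
    rintro _ ⟨g, rfl⟩
    refine ⟨c, le_rfl, ?_⟩
    simp only
    rw [pairCov_apply_pair h (Finset.mem_univ g), Matrix.one_apply_ne (hab g).ne, zero_sub,
      neg_neg, hεc]

end Support

/-- The bound on the power for fixed dimensions and sample sizes. -/
lemma iSup_iInf_rejectProb_le {p m s n₁ n₂ : ℕ} {K : Params} (hK : K.Admissible)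
    {α β c ε η : ℝ} (hα : 0 ≤ α) (hη : 0 ≤ η) (hs : 0 < s) (hms : 2 * (m * s) ≤ p) (hε : 0 < ε)
    (hsmall : K.IsSmall ε) (hsmall' : K.IsSmall (-ε)) (hm : m = ⌊numEntries p ^ (1 - β)⌋₊)
    (hεc : ε = √(2 * c * Real.log (numEntries p) / effSize n₁ n₂))
    (hχ : √(Real.exp (m * ((1 - ε ^ 2)⁻¹ ^ min n₁ n₂ / (s * s : ℕ))) - 1) ≤ η)
    (μ₁ μ₂ : Vec p) :
    (⨆ W ∈ levelTests n₁ n₂ K α μ₁ μ₂, ⨅ S ∈ sparseClass n₁ n₂ K β c μ₁ μ₂,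
      rejectProb μ₁ μ₂ S.1 S.2 W) ≤ ENNReal.ofReal (α + η) := by
  have : Nonempty (Fin s) := ⟨⟨0, hs⟩⟩
  obtain ⟨left, right, hinj, hlt⟩ := exists_injective_halves hms
  refine iSup₂_le fun W hW => ?_
  obtain ⟨hWm, hW1, hlevel⟩ := hW
  -- The null pair of identity matrices is regular as the case `ε = 0` of an arbitrary choice.
  obtain ⟨π, hπ⟩ := exists_perm_adjacent (injective_choice hinj fun _ => (⟨0, hs⟩, ⟨0, hs⟩))
  have hnull := regular_pairCov hK (Params.isSmall_zero hK) (Params.isSmall_zero hK)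
    (injective_choice hinj fun _ => (⟨0, hs⟩, ⟨0, hs⟩)) π hπ μ₁ μ₂
  rw [pairCov_zero] at hnull
  have hsize := hlevel 1 hnull
  rw [ENNReal.ofReal_add hα hη]
  -- The smaller sample is the one perturbed, as it carries less information about `ε`.
  rcases le_total n₁ n₂ with hn | hn
  · rw [min_eq_left hn] at hχ
    obtain ⟨e, he⟩ := exists_rejectProb_left_le hsmall.lt_one hinj μ₁ μ₂ hWm hW1
    refine (iInf₂_le _ (mem_sparseClass_left hK (injective_choice hinj e) (fun g => hlt _ _) hε
      hsmall hm hεc μ₁ μ₂)).trans (he.trans (add_le_add hsize (ENNReal.ofReal_le_ofReal ?_)))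
    simpa using hχ
  · rw [min_eq_right hn] at hχ
    obtain ⟨e, he⟩ := exists_rejectProb_right_le hsmall'.lt_one hinj μ₁ μ₂ hWm hW1
    refine (iInf₂_le _ (mem_sparseClass_right hK (injective_choice hinj e) (fun g => hlt _ _) hε
      hsmall' hm hεc μ₁ μ₂)).trans (he.trans (add_le_add hsize (ENNReal.ofReal_le_ofReal ?_)))
    simpa using hχ

/-! ### Asymptotics -/

/-- The sum `n₁ + n₂` is at most twice the larger size. Without perturbing the smaller sample there
would be no such comparison. -/
lemma min_le_two_mul_effSize {n₁ n₂ : ℕ} (h : 0 < effSize n₁ n₂) :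
    ((min n₁ n₂ : ℕ) : ℝ) ≤ 2 * effSize n₁ n₂ := by
  have h1 : n₁ ≠ 0 := by
    rintro rfl
    simp [effSize] at h
  have h1' : (0 : ℝ) < n₁ := by exact_mod_cast Nat.pos_of_ne_zero h1
  have h2' : (0 : ℝ) ≤ n₂ := Nat.cast_nonneg _
  rw [effSize, ← mul_div_assoc, le_div_iff₀ (by linarith)]
  push_cast
  rcases le_total (n₁ : ℝ) n₂ with hn | hn
  · rw [min_eq_left hn]
    nlinarith
  · rw [min_eq_right hn]
    nlinarith

lemma inv_one_sub_le_exp {x : ℝ} (h0 : 0 ≤ x) (h1 : x ≤ 1 / 2) : (1 - x)⁻¹ ≤ Real.exp (2 * x) := by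
  refine le_trans ?_ (Real.add_one_le_exp _)
  rw [inv_le_iff_one_le_mul₀ (by linarith)]
  nlinarith

lemma numEntries_le_sq {p : ℕ} (hp : 1 ≤ p) : numEntries p ≤ (p : ℝ) ^ 2 := by
  have : (1 : ℝ) ≤ p := by exact_mod_cast hp
  rw [numEntries]
  nlinarith

lemma one_le_numEntries {p : ℕ} (hp : 1 ≤ p) : 1 ≤ numEntries p := by
  have : (1 : ℝ) ≤ p := by exact_mod_cast hp
  rw [numEntries]
  nlinarith

/-- The second moment of the average density. -/
lemma exponent_le {p n : ℕ} {β N x : ℝ} (hp : 1 ≤ p) (hN : 0 < N) (hn : (n : ℝ) ≤ 2 * N)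
    (hx : x = 2 * ((3 * β - 2) / 16) * Real.log (numEntries p) / N) (hx0 : 0 ≤ x)
    (hx1 : x ≤ 1 / 2) (hmp : 2 * ⌊numEntries p ^ (1 - β)⌋₊ ≤ p)
    (hm : 0 < ⌊numEntries p ^ (1 - β)⌋₊) :
    (⌊numEntries p ^ (1 - β)⌋₊ : ℝ) * ((1 - x)⁻¹ ^ n /
      ((p / (2 * ⌊numEntries p ^ (1 - β)⌋₊)) * (p / (2 * ⌊numEntries p ^ (1 - β)⌋₊)) : ℕ)) ≤
      16 * numEntries p ^ (-((3 * β - 2) / 2)) := by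
  set q := numEntries p with hq
  set m := ⌊q ^ (1 - β)⌋₊ with hmdef
  set s := p / (2 * m) with hs
  have hq1 : 1 ≤ q := one_le_numEntries hp
  have hq0 : 0 < q := by linarith
  have hqp : q ≤ (p : ℝ) ^ 2 := numEntries_le_sq hp
  have hs1 : 1 ≤ s := (Nat.one_le_div_iff (by omega)).2 hmp
  -- Rounding down in `p / (2m)` loses at most a factor two, because `s ≥ 1`.
  have hps : p ≤ 4 * (m * s) := by
    have h1 : p < 2 * m * (s + 1) := Nat.lt_mul_div_succ p (by omega)
    nlinarith [Nat.mul_le_mul_left m hs1]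
  have hps' : (p : ℝ) ≤ 4 * (m * s) := by exact_mod_cast hps
  have hs0 : (0 : ℝ) < s := by exact_mod_cast hs1
  have hm0 : (0 : ℝ) < m := by exact_mod_cast hm
  have hp0 : (0 : ℝ) < p := by exact_mod_cast hp
  have hpow : (1 - x)⁻¹ ^ n ≤ q ^ ((3 * β - 2) / 2) := by
    calc (1 - x)⁻¹ ^ n ≤ Real.exp (2 * x) ^ n :=
          pow_le_pow_left₀ (inv_nonneg.2 (by linarith)) (inv_one_sub_le_exp hx0 hx1) n
      _ = Real.exp (n * (2 * x)) := (Real.exp_nat_mul _ _).symm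
      _ ≤ Real.exp (2 * N * (2 * x)) := by gcongr
      -- The constant `1/16` in `x` gives `4 N x = ((3β - 2) / 2) log q`.
      _ = q ^ ((3 * β - 2) / 2) := by
          rw [Real.rpow_def_of_pos hq0, hx]
          congr 1
          field_simp
          ring
  have hmq : (m : ℝ) ≤ q ^ (1 - β) := Nat.floor_le (Real.rpow_nonneg hq0.le _)
  have hinv : ((s * s : ℕ) : ℝ)⁻¹ ≤ 16 * (m : ℝ) ^ 2 * q⁻¹ := by
    rw [inv_le_iff_one_le_mul₀ (by push_cast; positivity)]
    push_cast
    rw [show 16 * (m : ℝ) ^ 2 * q⁻¹ * (s * s) = (4 * (m * s)) ^ 2 / q by field_simp; ring,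
      one_le_div hq0]
    exact hqp.trans (pow_le_pow_left₀ hp0.le hps' 2)
  calc (m : ℝ) * ((1 - x)⁻¹ ^ n / ((s * s : ℕ) : ℝ))
      ≤ m * (q ^ ((3 * β - 2) / 2) * (16 * (m : ℝ) ^ 2 * q⁻¹)) := by
        rw [div_eq_mul_inv]
        gcongr
    _ = 16 * ((m : ℝ) ^ 3 * q ^ ((3 * β - 2) / 2) * q⁻¹) := by ring
    _ ≤ 16 * ((q ^ (1 - β)) ^ 3 * q ^ ((3 * β - 2) / 2) * q⁻¹) := by gcongr
    -- The exponents add up to `3(1 - β) + (3β - 2)/2 - 1 = -(3β - 2)/2`.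
    _ = 16 * q ^ (-((3 * β - 2) / 2)) := by
        rw [← Real.rpow_natCast, ← Real.rpow_mul hq0.le, ← Real.rpow_neg_one, ← Real.rpow_add hq0,
          ← Real.rpow_add hq0]
        congr 2
        push_cast
        ring

lemma tendsto_numEntries : Tendsto numEntries atTop atTop := by
  refine tendsto_atTop_mono' _ ?_ (tendsto_natCast_atTop_atTop (R := ℝ))
  filter_upwards [eventually_ge_atTop 1] with p hp
  have : (1 : ℝ) ≤ p := by exact_mod_cast hp
  rw [numEntries]
  nlinarith

lemma eventually_isSmall {K : Params} (hK : K.Admissible) : ∀ᶠ ε in nhds 0, K.IsSmall ε := by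
  have h1 : Tendsto (fun ε : ℝ => |ε|) (nhds 0) (nhds 0) := by
    simpa using (continuous_abs (G := ℝ)).tendsto 0
  have h2 : Tendsto (fun ε : ℝ => 2 * |ε|) (nhds 0) (nhds 0) := by
    simpa using h1.const_mul 2
  have h3 : ContinuousAt (fun ε : ℝ => √((1 - ε ^ 2)⁻¹ - 1)) 0 := by
    refine Real.continuous_sqrt.continuousAt.comp ?_
    refine ContinuousAt.sub (ContinuousAt.inv₀ (by fun_prop) (by norm_num)) continuousAt_const
  have h3' : Tendsto (fun ε : ℝ => √((1 - ε ^ 2)⁻¹ - 1)) (nhds 0) (nhds 0) := by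
    simpa using h3.tendsto
  filter_upwards [h1.eventually_lt_const one_pos,
    h2.eventually_lt_const (sub_pos.2 hK.ρ₀_mem.2),
    h3'.eventually_lt_const (mul_pos hK.C_pos hK.γ_mem.1)] with ε e1 e2 e3
  exact ⟨e1, e2, e3.le⟩

/-- The number of pairs is at most `p ^ (2(1 - β))`, of smaller order than `p` for `β > 1/2`, so
there is room for disjoint pairs. -/
lemma eventually_two_mul_floor_le {β : ℝ} (hβ : 1 / 2 < β) :
    ∀ᶠ p : ℕ in atTop, 2 * ⌊numEntries p ^ (1 - β)⌋₊ ≤ p := by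
  have h1 : Tendsto (fun p : ℕ => (p : ℝ) ^ (2 * β - 1)) atTop atTop :=
    (tendsto_rpow_atTop (by linarith)).comp tendsto_natCast_atTop_atTop
  by_cases hβ1 : β ≤ 1
  · filter_upwards [h1.eventually_ge_atTop 2, eventually_ge_atTop 1] with p hp hp1
    have hq := one_le_numEntries hp1
    have hp0 : (0 : ℝ) < p := by exact_mod_cast hp1
    have h2 : (⌊numEntries p ^ (1 - β)⌋₊ : ℝ) ≤ (p : ℝ) ^ (2 * (1 - β)) := by
      refine (Nat.floor_le (Real.rpow_nonneg (by linarith) _)).trans ?_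
      rw [Real.rpow_mul hp0.le]
      refine Real.rpow_le_rpow (by linarith) ?_ (by linarith)
      simpa using numEntries_le_sq hp1
    have h3 : 2 * (⌊numEntries p ^ (1 - β)⌋₊ : ℝ) ≤ p := by
      calc 2 * (⌊numEntries p ^ (1 - β)⌋₊ : ℝ) ≤ (p : ℝ) ^ (2 * β - 1) * (p : ℝ) ^ (2 * (1 - β)) :=
            mul_le_mul hp h2 (Nat.cast_nonneg _) (by positivity)
        _ = p := by
            rw [← Real.rpow_add hp0]
            ring_nf
            exact Real.rpow_one _
    exact_mod_cast h3
  · filter_upwards [eventually_ge_atTop 2] with p hp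
    have h4 : ⌊numEntries p ^ (1 - β)⌋₊ ≤ 1 := by
      have := Real.rpow_le_one_of_one_le_of_nonpos (one_le_numEntries (show 1 ≤ p by omega))
        (show 1 - β ≤ 0 by linarith)
      exact_mod_cast (Nat.floor_le_of_le (n := 1) (by simpa using this))
    omega

/-- Since `q ≤ p²`, `log q` is of order at most `log p`, which is negligible against `p ^ ξ`. -/
lemma PolynomialGrowth.tendsto_signal {ξ : ℝ} (hξ : 0 < ξ) {p n₁ n₂ : ℕ → ℕ}
    (h : PolynomialGrowth ξ p n₁ n₂) (c : ℝ) :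
    Tendsto (fun k => 2 * c * Real.log (numEntries (p k)) / effSize (n₁ k) (n₂ k)) atTop
      (nhds 0) := by
  have hp : Tendsto (fun k => (p k : ℝ)) atTop atTop := tendsto_natCast_atTop_atTop.comp h.dim
  have h1 : (fun k => Real.log (numEntries (p k))) =O[atTop] fun k => Real.log (p k : ℝ) := by
    refine IsBigO.of_bound 2 ?_
    filter_upwards [h.dim.eventually_ge_atTop 1] with k hk
    have hq := one_le_numEntries hk
    have hk' : (1 : ℝ) ≤ p k := by exact_mod_cast hk
    rw [Real.norm_of_nonneg (Real.log_nonneg hq), Real.norm_of_nonneg (Real.log_nonneg hk')]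
    have := Real.log_le_log (by linarith) (numEntries_le_sq hk)
    simpa [Real.log_pow] using this
  have h2 : (fun k => Real.log (p k : ℝ)) =o[atTop] fun k => (p k : ℝ) ^ ξ :=
    (isLittleO_log_rpow_atTop hξ).comp_tendsto hp
  have h3 := (h1.trans_isLittleO h2).trans_isBigO h.rate.2
  have h4 := h3.tendsto_div_nhds_zero.const_mul (2 * c)
  simpa [mul_div_assoc] using h4

end CovTest

/-! ### The choice of the constant and the limit. -/

theorem theorem3 (ξ α ω β : ℝ) (K : CovTest.Params) (hξ : ξ ∈ Set.Ioo (0 : ℝ) 2)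
    (hα : 0 < α) (hω : 0 < ω) (hωα : ω < 1 - α)
    (hβ : max (2 / 3) ((3 - ξ) / 4) < β) (hβ_lt : β < 1) (hK : K.Admissible) :
    ∃ c₀ : ℝ, 0 < c₀ ∧ ∀ p n₁ n₂ : ℕ → ℕ, CovTest.PolynomialGrowth ξ p n₁ n₂ →
      ∀ᶠ k in atTop, ∀ μ₁ μ₂ : CovTest.Vec (p k),
        (⨆ W ∈ CovTest.levelTests (n₁ k) (n₂ k) K α μ₁ μ₂,
          ⨅ S ∈ CovTest.sparseClass (n₁ k) (n₂ k) K β c₀ μ₁ μ₂,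
            CovTest.rejectProb μ₁ μ₂ S.1 S.2 W) ≤ ENNReal.ofReal (1 - ω) := by
  have hβ23 : 2 / 3 < β := (le_max_left _ _).trans_lt hβ
  have hexp : 0 < (3 * β - 2) / 2 := by linarith
  -- The choices leave the factor `q ^ (-(3β - 2))`; this `c₀` lets the likelihood ratios consume
  -- half of that exponent.
  refine ⟨(3 * β - 2) / 16, by linarith, fun p n₁ n₂ hgrowth => ?_⟩
  -- The slack between the level and the claimed power bound, to be compared with `√χ²` of the
  -- mixture.
  have hη : 0 < 1 - ω - α := by linarith
  have hx := hgrowth.tendsto_signal hξ.1 ((3 * β - 2) / 16)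
  have hε : Tendsto (fun k => √(2 * ((3 * β - 2) / 16) *
      Real.log (CovTest.numEntries (p k)) / CovTest.effSize (n₁ k) (n₂ k))) atTop (nhds 0) := by
    simpa [Function.comp_def] using (Real.continuous_sqrt.tendsto 0).comp hx
  have hq := CovTest.tendsto_numEntries.comp hgrowth.dim
  have hχ : Tendsto (fun k => √(Real.exp (16 * CovTest.numEntries (p k) ^
      (-((3 * β - 2) / 2))) - 1)) atTop (nhds 0) := by
    have h1 := ((tendsto_rpow_neg_atTop hexp).comp hq).const_mul 16
    have hc : Continuous fun y : ℝ => √(Real.exp y - 1) := by fun_prop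
    have h2 := (hc.tendsto (16 * 0)).comp h1
    simpa [Function.comp_def] using h2
  have hε' := hε.neg
  rw [neg_zero] at hε'
  filter_upwards [hx.eventually_le_const (show (0 : ℝ) < 1 / 2 by norm_num),
    hε.eventually (CovTest.eventually_isSmall hK),
    hε'.eventually (CovTest.eventually_isSmall hK),
    hχ.eventually_le_const hη, hq.eventually_gt_atTop 1,
    hgrowth.size.eventually_gt_atTop 0, hgrowth.dim.eventually_ge_atTop 1,
    hgrowth.dim.eventually (CovTest.eventually_two_mul_floor_le (show 1 / 2 < β by linarith))]
    with k k1 k2 k3 k4 k5 k6 k7 k8 μ₁ μ₂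
  simp only [Function.comp_apply] at k5
  have hxpos : 0 < 2 * ((3 * β - 2) / 16) * Real.log (CovTest.numEntries (p k)) /
      CovTest.effSize (n₁ k) (n₂ k) :=
    div_pos (mul_pos (by linarith) (Real.log_pos k5)) k6
  have hm : 0 < ⌊CovTest.numEntries (p k) ^ (1 - β)⌋₊ :=
    Nat.floor_pos.2 (Real.one_le_rpow k5.le (by linarith))
  have hbound := CovTest.exponent_le k7 k6 (CovTest.min_le_two_mul_effSize k6) rfl hxpos.le k1 k8 hm
  -- The group size `s` is `p / (2m)`, so that `2ms ≤ p`, and it is positive because `2m ≤ p`.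
  have hfin := CovTest.iSup_iInf_rejectProb_le (n₁ := n₁ k) (n₂ := n₂ k) hK hα.le hη.le
    (Nat.div_pos k8 (by omega)) (p := p k) (by
      rw [← mul_assoc]
      exact Nat.mul_div_le _ _) (Real.sqrt_pos.2 hxpos) k2 k3 rfl rfl
    (by
      refine le_trans (Real.sqrt_le_sqrt ?_) k4
      rw [Real.sq_sqrt hxpos.le]
      gcongr) μ₁ μ₂
  rwa [show α + (1 - ω - α) = 1 - ω by ring] at hfin
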